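/- Let $n,m$ be natural numbers, let $\Omega\subset\mathbb R^n\times\mathbb R^m$ be open, let $(\bar x,\bar u)\in\Omega$, and let $f$ be an $\mathbb R^n$-valued map on $\mathbb R^n\times\mathbb R^m$ that is real analytic on $\Omega$ (its values outside $\Omega$ do not matter). Consider the control system $\dot x=f(x,u)$ with state $x\in\mathbb R^n$ and control $u\in\mathbb R^m$. Definitions. A *solution* of $\dot x=f(x,u)$ that remains in an open set $O\subset\mathbb R^n\times\mathbb R^m$ is a map $\gamma=(\gamma_{\rm I},\gamma_{\rm II}):I\to O$ on a real interval $I$ that is Lebesgue measurable and locally bounded, with $\gamma_{\rm I}$ absolutely continuous on every compact subinterval of $I$, such that for all $[T_1,T_2]\subset I$ the map $t\mapsto f(\gamma(t))$ is integrable on $[T_1,T_2]$ and $\gamma_{\rm I}(T_2)-\gamma_{\rm I}(T_1)=\int_{T_1}^{T_2}f(\gamma(t))\,dt$. A homeomorphism $\chi:O\to O'$ between open subsets of $\mathbb R^n\times\mathbb R^m$ *conjugates* $\dot x=f(x,u)$ to $\dot z=g(z,v)$ if, for every real interval $I$, a map $\gamma:I\to O$ is a solution of the first system that remains in $O$ if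 and only if $\chi\circ\gamma$ is a solution of the second system that remains in $O'$. For $k\in\{\infty,\omega\}$ ($C^\omega$ meaning real analytic), $\chi$ is a *$C^k$ diffeomorphism* if $\chi$ and $\chi^{-1}$ are of class $C^k$; it is a *quasi-$C^k$ diffeomorphism* if it is a homeomorphism of the form $\chi(x,u)=(\chi_{\rm I}(x),\chi_{\rm II}(x,u))$ where $\chi_{\rm I}$ is a $C^k$ diffeomorphism from the projection of $O$ to $\mathbb R^n$ onto the projection of $O'$ to $\mathbb R^n$. The system $\dot x=f(x,u)$ is *locally $C^k$* (resp. *quasi-$C^k$*) *linearizable* at $(\bar x,\bar u)$ if there are matrices $A\in\mathbb R^{n\times n}$, $B\in\mathbb R^{n\times m}$ with $\operatorname{rank}(B,AB,\dots,A^{n-1}B)=n$, an open neighborhood $O$ of $(\bar x,\bar u)$, an open set $O'\subset\mathbb R^n\times\mathbb R^m$, and a $C^k$ diffeomorphism (resp. quasi-$C^k$ diffeomorphism) $\chi:O\to O'$ that conjugates $\dot x=f(x,u)$ to $\dot z=Az+Bv$. Claim. If $\dot x=f(x,u)$ is locally $C^\infty$ linearizable at $(\bar x,\bar u)$, then it is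 locally $C^\omega$ linearizable at $(\bar x,\bar u)$. If it is locally quasi-$C^\infty$ linearizable at $(\bar x,\bar u)$, then it is locally quasi-$C^\omega$ linearizable at $(\bar x,\bar u)$. -/

import Mathlib

open Set MeasureTheory Topology
open scoped ContDiff Matrix

namespace ControlSystem

/-- `ℝⁿ`. -/
abbrev E (n : ℕ) : Type := EuclideanSpace ℝ (Fin n)

/-- `γ`, restricted to the interval `I`, is a solution of the control system `ẋ = f (x, u)` that
remains in `Ω ⊆ ℝⁿ × ℝᵐ`. Here `(γ t).1` is the state and `(γ t).2` is the control.
The field `aemeasurable` says that `γ` is Lebesgue measurable on `I`; the field `integrable` makes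
the integrals in `integral_eq` meaningful (it is automatic when `f` is continuous on `ℝⁿ × ℝᵐ`,
since `γ` is measurable and locally bounded). -/
structure IsSolution {n m : ℕ} (f : E n × E m → E n) (Ω : Set (E n × E m)) (I : Set ℝ)
    (γ : ℝ → E n × E m) : Prop where
  mapsTo : MapsTo γ I Ω
  aemeasurable : AEMeasurable γ (volume.restrict I)
  locallyBounded : ∀ t ∈ I, ∃ U ∈ 𝓝[I] t, Bornology.IsBounded (γ '' U)
  absolutelyContinuous : ∀ a ∈ I, ∀ b ∈ I, a ≤ b →
    AbsolutelyContinuousOnInterval (fun t => (γ t).1) a b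
  integrable : ∀ a ∈ I, ∀ b ∈ I, a ≤ b → IntervalIntegrable (fun t => f (γ t)) volume a b
  integral_eq : ∀ a ∈ I, ∀ b ∈ I, a ≤ b → (γ b).1 - (γ a).1 = ∫ t in a..b, f (γ t)

/-- A homeomorphism `χ` from the open set `χ.source` onto the open set `χ.target` conjugates the
control systems `ẋ = f (x, u)` and `ż = g (z, v)`: for every real interval `I`, a map
`γ : I → χ.source` is a solution of the first system if and only if `χ ∘ γ` is a solution of the
second one. -/
def Conjugates {n m : ℕ} (f g : E n × E m → E n)
    (χ : OpenPartialHomeomorph (E n × E m) (E n × E m)) : Prop :=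
  ∀ (I : Set ℝ) (γ : ℝ → E n × E m), I.OrdConnected → MapsTo γ I χ.source →
    (IsSolution f χ.source I γ ↔ IsSolution g χ.target I (χ ∘ γ))

/-- `χ` is a `C^k` diffeomorphism from `χ.source` onto `χ.target`. -/
def IsDiffeo {V : Type*} [NormedAddCommGroup V] [NormedSpace ℝ V] (k : WithTop ℕ∞)
    (χ : OpenPartialHomeomorph V V) : Prop :=
  ContDiffOn ℝ k χ χ.source ∧ ContDiffOn ℝ k χ.symm χ.target

/-- `χ` is a quasi-`C^k` diffeomorphism: it is a homeomorphism of the triangular form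
`χ (x, u) = (χ₁ x, χ₂ (x, u))`, where `χ₁` is a `C^k` diffeomorphism from the projection of
`χ.source` on the state space onto the projection of `χ.target`. -/
def IsQuasiDiffeo {n m : ℕ} (k : WithTop ℕ∞)
    (χ : OpenPartialHomeomorph (E n × E m) (E n × E m)) : Prop :=
  ∃ χ₁ : OpenPartialHomeomorph (E n) (E n),
    χ₁.source = Prod.fst '' χ.source ∧ χ₁.target = Prod.fst '' χ.target ∧
    (∀ p ∈ χ.source, (χ p).1 = χ₁ p.1) ∧ IsDiffeo k χ₁

/-- `ẋ = f (x, u)` is locally `C^k` conjugate to `ż = g (z, v)` at the point `p`. -/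
def LocallyConjugate {n m : ℕ} (k : WithTop ℕ∞) (f g : E n × E m → E n) (p : E n × E m) : Prop :=
  ∃ χ : OpenPartialHomeomorph (E n × E m) (E n × E m),
    p ∈ χ.source ∧ IsDiffeo k χ ∧ Conjugates f g χ

/-- `ẋ = f (x, u)` is locally quasi-`C^k` conjugate to `ż = g (z, v)` at the point `p`. -/
def LocallyQuasiConjugate {n m : ℕ} (k : WithTop ℕ∞) (f g : E n × E m → E n) (p : E n × E m) :
    Prop :=
  ∃ χ : OpenPartialHomeomorph (E n × E m) (E n × E m),
    p ∈ χ.source ∧ IsQuasiDiffeo k χ ∧ Conjugates f g χ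

/-- The right-hand side of the linear control system `ż = A z + B v`. -/
def linearSystem {n m : ℕ} (A : Matrix (Fin n) (Fin n) ℝ) (B : Matrix (Fin n) (Fin m) ℝ) :
    E n × E m → E n :=
  fun p => WithLp.toLp 2 (A *ᵥ p.1.ofLp + B *ᵥ p.2.ofLp)

/-- The block matrix `(B, AB, …, A^(n-1)B)`. -/
def kalmanMatrix {n m : ℕ} (A : Matrix (Fin n) (Fin n) ℝ) (B : Matrix (Fin n) (Fin m) ℝ) :
    Matrix (Fin n) (Fin n × Fin m) ℝ :=
  Matrix.of fun i j => (A ^ (j.1 : ℕ) * B) i j.2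

/-- Kalman's criterion for the controllability of `ż = A z + B v`. -/
def IsControllable {n m : ℕ} (A : Matrix (Fin n) (Fin n) ℝ) (B : Matrix (Fin n) (Fin m) ℝ) :
    Prop :=
  (kalmanMatrix A B).rank = n

/-- `ẋ = f (x, u)` is locally `C^k` linearizable at `p`. -/
def LocallyLinearizable {n m : ℕ} (k : WithTop ℕ∞) (f : E n × E m → E n) (p : E n × E m) : Prop :=
  ∃ (A : Matrix (Fin n) (Fin n) ℝ) (B : Matrix (Fin n) (Fin m) ℝ),
    IsControllable A B ∧ LocallyConjugate k f (linearSystem A B) p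

/-- `ẋ = f (x, u)` is locally quasi-`C^k` linearizable at `p`. -/
def LocallyQuasiLinearizable {n m : ℕ} (k : WithTop ℕ∞) (f : E n × E m → E n) (p : E n × E m) :
    Prop :=
  ∃ (A : Matrix (Fin n) (Fin n) ℝ) (B : Matrix (Fin n) (Fin m) ℝ),
    IsControllable A B ∧ LocallyQuasiConjugate k f (linearSystem A B) p

end ControlSystem

/-! Changing the control at a single instant leaves a solution a solution, so the state component of
a conjugacy is a function `φ` of the state alone. Following trajectories with constant control then
gives the conjugacy equation `Dφ(x) f(x,u) = A φ(x) + B ψ(x,u)`, where `ψ` is the control component.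
Conversely, a triangular local homeomorphism satisfying this equation, with a `C¹` diffeomorphism on
the state, is a conjugacy on a small domain. The core is therefore to replace `φ` by an analytic
local diffeomorphism `φ'` with `Dφ' f - A φ'` in the range `W` of `B`.

This is done by induction on the dimension of the state. Write the state space as `Y ⊕ W`. The
distribution `(Dφ)⁻¹ W` is a priori only continuous, but it is spanned by differences `f(x,uᵢ) -
f(x,ū)`, which are analytic. The flows of these fields preserve the `Y`-part of `φ`, so they yield
analytic coordinates `(y,w)` in which that part is a function `h(y)`; no involutivity argument is
needed. The velocity of `y` does not depend on `u`. It defines an analytic system on `Y` with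
control `w`, which `h` and the `W`-part of `φ` bring to a controllable pair `(A₁, A₂)`. Induction
gives an analytic `T₁` on `Y`, a control transformation `T₂` completes it, and `φ' = (T₁, T₂)`
works: its `Y`-equation is exact, and its `W`-equation imposes nothing.

In the smooth case `φ'` is completed by an analytic control component. In the quasi case `∂f/∂u` may
degenerate although the given control component is a homeomorphism. The completion is then made on
the linear system, for the transition `φ' ∘ χ₁⁻¹`, and composed with the given conjugacy. -/

open scoped BoundedContinuousFunction

namespace ControlSystem

/-! ### Superposition operators on continuous maps. -/

section Superposition

variable {K E F : Type*} [TopologicalSpace K] [CompactSpace K]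
  [NormedAddCommGroup E] [NormedSpace ℝ E] [NormedAddCommGroup F] [NormedSpace ℝ F]

/-- A continuous multilinear map acts pointwise on continuous maps. -/
noncomputable def pointwiseMultilinear (K : Type*) [TopologicalSpace K] [CompactSpace K] {k : ℕ}
    (a : E [×k]→L[ℝ] F) : (K →ᵇ E) [×k]→L[ℝ] (K →ᵇ F) :=
  MultilinearMap.mkContinuous
    { toFun := fun h => BoundedContinuousFunction.mkOfCompact ⟨fun s => a fun i => h i s, by fun_prop⟩
      map_update_add' := by
        intro _ h i x y
        ext s
        have key : ∀ z : (K →ᵇ E), (fun j => Function.update h i z j s) =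
            Function.update (fun j => h j s) i (z s) := by
          intro z
          funext j
          by_cases hj : j = i
          · subst hj; simp
          · simp [hj]
        simp [key]
      map_update_smul' := by
        intro _ h i c x
        ext s
        have key : ∀ z : (K →ᵇ E), (fun j => Function.update h i z j s) =
            Function.update (fun j => h j s) i (z s) := by
          intro z
          funext j
          by_cases hj : j = i
          · subst hj; simp
          · simp [hj]
        simp [key] } ‖a‖ (by
    intro h
    refine (BoundedContinuousFunction.norm_le (by positivity)).2 fun s => ?_
    refine (a.le_opNorm _).trans ?_
    gcongr with i
    exact (h i).norm_coe_le_norm s)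

theorem norm_pointwiseMultilinear_le {k : ℕ} (a : E [×k]→L[ℝ] F) :
    ‖pointwiseMultilinear K a‖ ≤ ‖a‖ :=
  MultilinearMap.mkContinuous_norm_le _ (norm_nonneg _) _

/-- Superposition with an analytic map is analytic on spaces of continuous maps. -/
theorem exists_analyticAt_superposition [CompleteSpace F] {G : E → F} {x₀ : E}
    (hG : AnalyticAt ℝ G x₀) :
    ∃ N : (K →ᵇ E) → (K →ᵇ F), AnalyticAt ℝ N (BoundedContinuousFunction.const K x₀) ∧
      ∀ᶠ H in 𝓝 (BoundedContinuousFunction.const K x₀), ∀ s, N H s = G (H s) := by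
  obtain ⟨p, r, hp⟩ := hG
  let P : FormalMultilinearSeries ℝ (K →ᵇ E) (K →ᵇ F) := fun k => pointwiseMultilinear K (p k)
  obtain ⟨ρ, hρ0, hρ⟩ := ENNReal.lt_iff_exists_nnreal_btwn.1 (hp.r_pos)
  have hρ0' : 0 < ρ := by exact_mod_cast hρ0
  -- The pointwise coefficients have norms at most those of `p`, so the radius of convergence is not
  -- lost.
  have hrad : (ρ : ENNReal) ≤ P.radius := by
    obtain ⟨C, -, hC⟩ := p.norm_mul_pow_le_of_lt_radius (hρ.trans_le hp.r_le)
    refine P.le_radius_of_bound C fun k => le_trans ?_ (hC k)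
    gcongr
    exact norm_pointwiseMultilinear_le _
  have hPpos : 0 < P.radius := hρ0.trans_le hrad
  have hP := P.hasFPowerSeriesOnBall hPpos
  refine ⟨fun H => P.sum (H - BoundedContinuousFunction.const K x₀), ?_, ?_⟩
  · have h0 : AnalyticAt ℝ P.sum (BoundedContinuousFunction.const K x₀ - BoundedContinuousFunction.const K x₀) := by
      rw [sub_self]; exact hP.analyticAt
    exact AnalyticAt.fun_comp (f := fun H => H - BoundedContinuousFunction.const K x₀) h0
      (analyticAt_id.sub analyticAt_const)
  · have hball : Metric.ball (BoundedContinuousFunction.const K x₀) ρ ∈ 𝓝 (BoundedContinuousFunction.const K x₀) :=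
      Metric.ball_mem_nhds _ (by exact_mod_cast hρ0')
    filter_upwards [hball] with H hH s
    have hH' : ‖H - BoundedContinuousFunction.const K x₀‖ < ρ := by
      rwa [Metric.mem_ball, dist_eq_norm] at hH
    have hHs : ‖H s - x₀‖ < ρ :=
      lt_of_le_of_lt ((H - BoundedContinuousFunction.const K x₀).norm_coe_le_norm s) hH'
    have h1 : HasSum (fun k => P k fun _ => H - BoundedContinuousFunction.const K x₀)
        (P.sum (H - BoundedContinuousFunction.const K x₀)) := by
      refine P.hasSum (Metric.eball_subset_eball hrad ?_)
      rw [Metric.mem_eball, edist_zero_right, enorm_eq_nnnorm]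
      exact_mod_cast hH'
    have h2 := h1.mapL (BoundedContinuousFunction.evalCLM ℝ s)
    have h3 : HasSum (fun k => p k fun _ => H s - x₀) (G (x₀ + (H s - x₀))) := by
      refine hp.hasSum ?_
      refine Metric.eball_subset_eball hρ.le ?_
      rw [Metric.mem_eball, edist_zero_right, enorm_eq_nnnorm]
      exact_mod_cast hHs
    rw [add_sub_cancel] at h3
    exact h2.unique h3

end Superposition

/-! ### Analytic dependence of flows on the initial point and on parameters. -/

section Flow

variable {X W : Type*} [NormedAddCommGroup X] [NormedSpace ℝ X]
  [NormedAddCommGroup W] [NormedSpace ℝ W]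

/-- The primitive vanishing at `0` of a continuous map on the unit interval. -/
noncomputable def primitiveCLM (X : Type*) [NormedAddCommGroup X] [NormedSpace ℝ X] :
    (unitInterval →ᵇ X) →L[ℝ] (unitInterval →ᵇ X) :=
  LinearMap.mkContinuous
    { toFun := fun H => BoundedContinuousFunction.mkOfCompact ⟨fun s => ∫ t in (0 : ℝ)..s, H (projIcc 0 1 zero_le_one t), by
        have : Continuous fun s : ℝ => ∫ t in (0 : ℝ)..s, H (projIcc 0 1 zero_le_one t) :=
          intervalIntegral.continuous_primitive
            (fun a b => (H.continuous.comp continuous_projIcc).intervalIntegrable a b) 0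
        exact this.comp continuous_subtype_val⟩
      map_add' := fun H₁ H₂ => by
        ext s
        exact intervalIntegral.integral_add
          ((H₁.continuous.comp continuous_projIcc).intervalIntegrable _ _)
          ((H₂.continuous.comp continuous_projIcc).intervalIntegrable _ _)
      map_smul' := fun c H => by
        ext s
        exact intervalIntegral.integral_smul _ _ } 1 (by
    intro H
    refine (BoundedContinuousFunction.norm_le (by positivity)).2 fun s => ?_
    have h := intervalIntegral.norm_integral_le_of_norm_le_const (a := 0) (b := (s : ℝ))
      (f := fun t => H (projIcc 0 1 zero_le_one t)) (C := ‖H‖)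
      (fun t _ => H.norm_coe_le_norm _)
    refine h.trans ?_
    have hs := s.2
    rw [sub_zero, abs_of_nonneg hs.1, one_mul]
    exact mul_le_of_le_one_right (norm_nonneg _) hs.2)

/-- Pointwise evaluation of an operator-valued continuous map at a fixed vector. -/
noncomputable def applyConstCLM (X W : Type*) [NormedAddCommGroup X] [NormedSpace ℝ X]
    [NormedAddCommGroup W] [NormedSpace ℝ W] :
    (unitInterval →ᵇ (W →L[ℝ] X)) →L[ℝ] W →L[ℝ] (unitInterval →ᵇ X) :=
  LinearMap.mkContinuous₂
    (LinearMap.mk₂ ℝ (fun (D : (unitInterval →ᵇ (W →L[ℝ] X))) (w : W) =>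
        BoundedContinuousFunction.mkOfCompact (α := unitInterval) ⟨fun s => D s w, by fun_prop⟩)
      (fun _ _ _ => by ext; simp) (fun _ _ _ => by ext; simp)
      (fun _ _ _ => by ext; simp) (fun _ _ _ => by ext; simp)) 1 (by
    intro D w
    refine (BoundedContinuousFunction.norm_le (by positivity)).2 fun s => ?_
    rw [one_mul]
    exact ((D s).le_opNorm w).trans (by gcongr; exact D.norm_coe_le_norm s))

/-- Constant maps on the unit interval. -/
noncomputable def constCLM (X : Type*) [NormedAddCommGroup X] [NormedSpace ℝ X] :
    X →L[ℝ] (unitInterval →ᵇ X) :=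
  LinearMap.mkContinuous
    { toFun := fun x => BoundedContinuousFunction.const _ x
      map_add' := fun _ _ => rfl
      map_smul' := fun _ _ => rfl } 1 (by
    intro x
    exact (BoundedContinuousFunction.norm_le (by positivity)).2 fun s => by
      rw [one_mul]; exact le_rfl)

/-- The map `(a, b, c) ↦ (a, b, c - R (a, b))`, as an automorphism. -/
noncomputable def shearEquiv {V V' : Type*} [NormedAddCommGroup V] [NormedSpace ℝ V]
    [NormedAddCommGroup V'] [NormedSpace ℝ V'] (R : V →L[ℝ] V') : (V × V') ≃L[ℝ] (V × V') :=
  ContinuousLinearEquiv.equivOfInverse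
    ((ContinuousLinearMap.fst ℝ V V').prod
      (ContinuousLinearMap.snd ℝ V V' - R ∘L ContinuousLinearMap.fst ℝ V V'))
    ((ContinuousLinearMap.fst ℝ V V').prod
      (ContinuousLinearMap.snd ℝ V V' + R ∘L ContinuousLinearMap.fst ℝ V V'))
    (fun p => by ext <;> simp) (fun p => by ext <;> simp)

/-- Analytic dependence on `(x, w)` of the solution `c` of `c = κ x + β (N c) w`. -/
theorem exists_analytic_solution {C D : Type*} [NormedAddCommGroup C] [NormedSpace ℝ C]
    [CompleteSpace C] [NormedAddCommGroup D] [NormedSpace ℝ D] [CompleteSpace D]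
    [CompleteSpace X] [CompleteSpace W]
    (κ : X →L[ℝ] C) (β : D →L[ℝ] W →L[ℝ] C) {N : C → D} {x₀ : X} (hN : AnalyticAt ℝ N (κ x₀)) :
    ∃ c : X × W → C, AnalyticAt ℝ c (x₀, 0) ∧ c (x₀, 0) = κ x₀ ∧
      HasFDerivAt c (κ ∘L ContinuousLinearMap.fst ℝ X W +
        β (N (κ x₀)) ∘L ContinuousLinearMap.snd ℝ X W) (x₀, 0) ∧
      ∀ᶠ p in 𝓝 ((x₀, 0) : X × W), c p = κ p.1 + β (N (c p)) p.2 := by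
  let Φ : (X × W) × C → (X × W) × C := fun z => (z.1, z.2 - κ z.1.1 - β (N z.2) z.1.2)
  let R : X × W →L[ℝ] C := κ ∘L ContinuousLinearMap.fst ℝ X W +
    β (N (κ x₀)) ∘L ContinuousLinearMap.snd ℝ X W
  let z₀ : (X × W) × C := ((x₀, 0), κ x₀)
  have hNz : AnalyticAt ℝ (fun z : (X × W) × C => N z.2) z₀ :=
    AnalyticAt.fun_comp (f := fun z : (X × W) × C => z.2) hN analyticAt_snd
  have hΦ : ContDiffAt ℝ ω Φ z₀ := by
    have h1 : ContDiffAt ℝ ω (fun z : (X × W) × C => N z.2) z₀ := hNz.contDiffAt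
    have h2 : ContDiffAt ℝ ω (fun z : (X × W) × C => β (N z.2)) z₀ :=
      β.contDiff.contDiffAt.fun_comp z₀ h1
    have h3 : ContDiffAt ℝ ω (fun z : (X × W) × C => κ z.1.1) z₀ :=
      κ.contDiff.contDiffAt.fun_comp z₀ contDiffAt_fst.fst
    exact contDiffAt_fst.prodMk ((contDiffAt_snd.sub h3).sub (h2.clm_apply contDiffAt_fst.snd))
  have hΦ' : HasFDerivAt Φ ((shearEquiv R : ((X × W) × C) ≃L[ℝ] ((X × W) × C)) :
      (X × W) × C →L[ℝ] (X × W) × C) z₀ := by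
    have h1 : HasFDerivAt (fun z : (X × W) × C => N z.2) _ z₀ :=
      hNz.differentiableAt.hasFDerivAt
    have h2 := (hasFDerivAt_fst (𝕜 := ℝ) (p := z₀)).snd
    have h3 := (β.hasFDerivAt.comp z₀ h1).clm_apply h2
    have h4 := (hasFDerivAt_fst (𝕜 := ℝ) (p := z₀)).fst
    have h5 := (hasFDerivAt_fst (𝕜 := ℝ) (p := z₀)).prodMk
      (((hasFDerivAt_snd (𝕜 := ℝ) (p := z₀)).sub (κ.hasFDerivAt.comp z₀ h4)).sub h3)
    refine h5.congr_fderiv ?_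
    refine ContinuousLinearMap.ext fun d => ?_
    refine Prod.ext rfl ?_
    simp [shearEquiv, R, z₀, sub_sub]
  have hΦ0 : Φ z₀ = ((x₀, 0), 0) := by simp [Φ, z₀]
  have hω : (ω : WithTop ℕ∞) ≠ 0 := by simp
  set Ψ := hΦ.localInverse hΦ' hω with hΨdef
  have hΨ : ContDiffAt ℝ ω Ψ ((x₀, 0), 0) := by
    have := hΦ.to_localInverse hΦ' hω
    rwa [hΦ0] at this
  have hs := hΦ.hasStrictFDerivAt' hΦ' hω
  have hΨ0 : Ψ ((x₀, 0), 0) = z₀ := by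
    have := hΦ.localInverse_apply_image hΦ' hω
    rwa [hΦ0] at this
  have hΨ' : HasFDerivAt Ψ ((shearEquiv R).symm : (X × W) × C →L[ℝ] (X × W) × C)
      ((x₀, 0), 0) := by
    have := hs.to_localInverse.hasFDerivAt
    rwa [hΦ0] at this
  have hright : ∀ᶠ z in 𝓝 (((x₀, 0), 0) : (X × W) × C), Φ (Ψ z) = z := by
    have := hs.eventually_right_inverse
    rwa [hΦ0] at this
  let ι : X × W →L[ℝ] (X × W) × C := ContinuousLinearMap.inl ℝ _ _
  refine ⟨fun p => (Ψ (ι p)).2, ?_, ?_, ?_, ?_⟩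
  · refine ContDiffAt.analyticAt ?_
    exact ContDiffAt.snd (ContDiffAt.comp (x₀, (0 : W)) (g := Ψ) hΨ ι.contDiff.contDiffAt)
  · change (Ψ ((x₀, 0), 0)).2 = κ x₀
    rw [hΨ0]
  · have := (HasFDerivAt.comp (x₀, (0 : W)) (g := Ψ) hΨ' ι.hasFDerivAt).snd
    refine this.congr_fderiv ?_
    refine ContinuousLinearMap.ext fun d => ?_
    have e : (shearEquiv R).symm (d, 0) = (d, R d) := by
      rw [ContinuousLinearEquiv.symm_apply_eq]
      simp [shearEquiv]
    change ((shearEquiv R).symm (d, 0)).2 = R d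
    rw [e]
  · have hri : ∀ᶠ p in 𝓝 ((x₀, 0) : X × W), Φ (Ψ (ι p)) = ι p :=
      (ι.continuous.tendsto (x₀, (0 : W))).eventually hright
    filter_upwards [hri] with p h3
    have e1 : (Ψ (ι p)).1 = p := congrArg Prod.fst h3
    have e2 : (Ψ (ι p)).2 - κ p.1 - β (N (Ψ (ι p)).2) p.2 = 0 := by
      have := congrArg Prod.snd h3
      simp only [Φ, e1] at this
      exact this
    rwa [sub_sub, sub_eq_zero] at e2

/-- Time-one maps of the vector fields `x ↦ G x w` depend analytically on the initial point
and on `w`; they preserve every function annihilated by these vector fields. -/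
theorem exists_analytic_flow [CompleteSpace X] [CompleteSpace W] {G : X → W →L[ℝ] X} {x₀ : X}
    (hG : AnalyticAt ℝ G x₀) :
    ∃ Ξ : X × W → X, AnalyticAt ℝ Ξ (x₀, 0) ∧ Ξ (x₀, 0) = x₀ ∧
      HasFDerivAt Ξ (ContinuousLinearMap.fst ℝ X W + G x₀ ∘L ContinuousLinearMap.snd ℝ X W)
        (x₀, 0) ∧
      ∀ {Y : Type} [NormedAddCommGroup Y] [NormedSpace ℝ Y] (q : X → Y),
        (∀ᶠ x in 𝓝 x₀, DifferentiableAt ℝ q x ∧ ∀ w, fderiv ℝ q x (G x w) = 0) →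
        ∀ᶠ p in 𝓝 ((x₀, 0) : X × W), q (Ξ p) = q p.1 := by
  obtain ⟨N, hN, hNG⟩ := exists_analyticAt_superposition (K := unitInterval) hG
  set c₀ : (unitInterval →ᵇ X) := BoundedContinuousFunction.const _ x₀ with hc₀
  have hN0 : N c₀ = BoundedContinuousFunction.const _ (G x₀) := by
    ext1 s
    exact hNG.self_of_nhds s
  -- The equation solved is the integral form of `c' = G(c) w`, `c(0) = x` on the unit interval.
  -- Small `w` replaces small time.
  obtain ⟨Ψ, hΨ, hΨ0, hΨ', hΨeq⟩ := exists_analytic_solution (constCLM X)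
    ((ContinuousLinearMap.compL ℝ W (unitInterval →ᵇ X) (unitInterval →ᵇ X) (primitiveCLM X)).comp
      (applyConstCLM X W)) (N := N) (x₀ := x₀) hN
  let ev : (unitInterval →ᵇ X) →L[ℝ] X := BoundedContinuousFunction.evalCLM ℝ (1 : unitInterval)
  have hcont : Filter.Tendsto Ψ (𝓝 (x₀, 0)) (𝓝 c₀) := by
    have h := hΨ.continuousAt.tendsto
    rwa [hΨ0] at h
  refine ⟨fun p => ev (Ψ p), ev.analyticAt _ |>.fun_comp hΨ, ?_, ?_, ?_⟩
  · change ev (Ψ (x₀, 0)) = x₀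
    rw [hΨ0]; rfl
  · refine (ev.hasFDerivAt.comp (x₀, (0 : W)) hΨ').congr_fderiv ?_
    refine ContinuousLinearMap.ext fun d => ?_
    change d.1 + (∫ t in (0 : ℝ)..(1 : unitInterval), N c₀ (projIcc 0 1 zero_le_one t) d.2) = _
    rw [hN0]
    simp
  · intro Y _ _ q hq
    have hV : ∀ᶠ H in 𝓝 c₀, ∀ s : unitInterval,
        DifferentiableAt ℝ q (H s) ∧ ∀ w, fderiv ℝ q (H s) (G (H s) w) = 0 := by
      obtain ⟨ε, hε, hball⟩ := Metric.eventually_nhds_iff_ball.1 hq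
      filter_upwards [Metric.ball_mem_nhds c₀ hε] with H hH s
      exact hball _ (lt_of_le_of_lt (BoundedContinuousFunction.dist_coe_le_dist s) hH)
    filter_upwards [hcont.eventually hV, hcont.eventually hNG, hΨeq] with p h1 h2 h3
    set D := Ψ p
    have e3 : ∀ s, D s = p.1 + ∫ t in (0 : ℝ)..s, (N D (projIcc 0 1 zero_le_one t)) p.2 :=
      fun s => congrArg (fun H : (unitInterval →ᵇ X) => H s) h3
    -- `c` extends the curve `D` to the whole line, so that two-sided derivatives exist at the
    -- endpoints too.
    let c : ℝ → X := fun s => p.1 + ∫ t in (0 : ℝ)..s, (N D (projIcc 0 1 zero_le_one t)) p.2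
    have hcu : Continuous fun t : ℝ => (N D (projIcc 0 1 zero_le_one t)) p.2 :=
      ((N D).continuous.comp continuous_projIcc).clm_apply continuous_const
    have hc : ∀ t, HasDerivAt c ((N D (projIcc 0 1 zero_le_one t)) p.2) t := fun t =>
      (hcu.integral_hasStrictDerivAt 0 t).hasDerivAt.const_add _
    have hcD : ∀ t (ht : t ∈ Icc (0 : ℝ) 1), c t = D ⟨t, ht⟩ := fun t ht => (e3 ⟨t, ht⟩).symm
    have hqc : ∀ t ∈ Icc (0 : ℝ) 1, HasDerivAt (fun t => q (c t)) 0 t := by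
      intro t ht
      have h5 := hc t
      rw [projIcc_of_mem zero_le_one ht, h2, ← hcD t ht] at h5
      have h6 := h1 ⟨t, ht⟩
      rw [← hcD t ht] at h6
      have := h6.1.hasFDerivAt.comp_hasDerivAt t h5
      rwa [h6.2] at this
    have hconst := constant_of_has_deriv_right_zero (f := fun t => q (c t)) (a := 0) (b := 1)
      (fun t ht => (hqc t ht).continuousAt.continuousWithinAt)
      (fun t ht => (hqc t (Ico_subset_Icc_self ht)).hasDerivWithinAt) 1 (by simp)
    have hc1 : c 1 = ev (Ψ p) := hcD 1 (by simp)
    have hc0 : c 0 = p.1 := by simp [c]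
    simpa only [hc1, hc0] using hconst

end Flow

/-! ### Local inversion. -/

section LocalInverse

variable {V V' : Type*} [NormedAddCommGroup V] [NormedSpace ℝ V] [NormedAddCommGroup V']
  [NormedSpace ℝ V']

theorem exists_local_inverse [CompleteSpace V] {n : WithTop ℕ∞} (hn : n ≠ 0) {ξ : V → V'} {a : V}
    {b : V'} (hab : ξ a = b) {e : V ≃L[ℝ] V'} (hξ : ContDiffAt ℝ n ξ a)
    (he : HasFDerivAt ξ (e : V →L[ℝ] V') a) :
    ∃ θ : V' → V, ContDiffAt ℝ n θ b ∧ θ b = a ∧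
      HasFDerivAt θ (e.symm : V' →L[ℝ] V) b ∧
      (∀ᶠ v in 𝓝 a, θ (ξ v) = v) ∧ ∀ᶠ v in 𝓝 b, ξ (θ v) = v := by
  subst hab
  have hs := hξ.hasStrictFDerivAt' he hn
  exact ⟨hξ.localInverse he hn, hξ.to_localInverse he hn, hξ.localInverse_apply_image he hn,
    hs.to_localInverse.hasFDerivAt, hs.eventually_left_inverse, hs.eventually_right_inverse⟩

theorem exists_continuousLinearEquiv_of_injective [FiniteDimensional ℝ V] {L : V →L[ℝ] V}
    (hL : Function.Injective L) : ∃ e : V ≃L[ℝ] V, (e : V →L[ℝ] V) = L :=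
  ⟨(LinearEquiv.ofInjectiveEndo (L : V →ₗ[ℝ] V) hL).toContinuousLinearEquiv, by ext; rfl⟩

end LocalInverse

/-! ### Completing a state transformation by a control transformation. -/

variable {X U : Type*} [NormedAddCommGroup X] [NormedSpace ℝ X] [FiniteDimensional ℝ X]
  [NormedAddCommGroup U] [NormedSpace ℝ U] [FiniteDimensional ℝ U]

/-- `B` need be neither injective nor surjective; with such a `B'`, the map `id - B' B` is a
projection onto the kernel of `B`. -/
theorem exists_generalized_inverse (B : U →L[ℝ] X) :
    ∃ B' : X →L[ℝ] U, ∀ z ∈ LinearMap.range (B : U →ₗ[ℝ] X), B (B' z) = z := by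
  obtain ⟨s, hs⟩ := LinearMap.exists_rightInverse_of_surjective (B : U →ₗ[ℝ] X).rangeRestrict
    (LinearMap.range_rangeRestrict _)
  obtain ⟨π, hπ⟩ := LinearMap.exists_leftInverse_of_injective
    (LinearMap.range (B : U →ₗ[ℝ] X)).subtype (Submodule.ker_subtype _)
  refine ⟨LinearMap.toContinuousLinearMap (s ∘ₗ π), fun z hz => ?_⟩
  have h1 : π z = ⟨z, hz⟩ := LinearMap.congr_fun hπ ⟨z, hz⟩
  have h2 := congrArg Subtype.val (LinearMap.congr_fun hs ⟨z, hz⟩)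
  change B (s (π z)) = z
  rw [h1]
  exact h2

/-- A state transformation `φ` bringing `f` to the form `A z` modulo the range of `B` can be
completed by a control transformation. -/
theorem exists_control_transformation {k k' : WithTop ℕ∞} (hk : k ≠ 0) (hkk' : k + 1 ≤ k')
    {A : X →L[ℝ] X} {B : U →L[ℝ] X} {f : X × U → X} {p : X × U} (hf : ContDiffAt ℝ k f p)
    {φ : X → X} (hφ : ContDiffAt ℝ k' φ p.1) (hφ' : Function.Injective (fderiv ℝ φ p.1))
    (hmem : ∀ᶠ q in 𝓝 p, fderiv ℝ φ q.1 (f q) - A (φ q.1) ∈ LinearMap.range (B : U →ₗ[ℝ] X))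
    {M : U →L[ℝ] U} (hM : Function.Injective M)
    (hker : ∀ d, fderiv ℝ f p (0, d) = 0 → B (M d) = 0) :
    ∃ ψ : X × U → U, ContDiffAt ℝ k ψ p ∧
      (∀ᶠ q in 𝓝 p, fderiv ℝ φ q.1 (f q) = A (φ q.1) + B (ψ q)) ∧
      ∃ e : (X × U) ≃L[ℝ] (X × U),
        HasFDerivAt (fun q : X × U => (φ q.1, ψ q)) (e : X × U →L[ℝ] X × U) p := by
  obtain ⟨B', hB'⟩ := exists_generalized_inverse B
  have hBB : ∀ u, B (B' (B u)) = B u := fun u => hB' _ ⟨u, rfl⟩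
  have hk1 : k' ≠ 0 := by
    rintro rfl
    simp at hkk'
  let r : X × U → X := fun q => fderiv ℝ φ q.1 (f q) - A (φ q.1)
  have hdφ : ContDiffAt ℝ k (fun q : X × U => fderiv ℝ φ q.1) p :=
    (hφ.fderiv_right hkk').fun_comp p contDiffAt_fst
  have hφk : ContDiffAt ℝ k (fun q : X × U => φ q.1) p :=
    (hφ.of_le (le_self_add.trans hkk')).fun_comp p contDiffAt_fst
  have hr : ContDiffAt ℝ k r p :=
    (hdφ.clm_apply hf).sub (A.contDiff.contDiffAt.fun_comp p hφk)
  let Q : U →L[ℝ] U := ContinuousLinearMap.id ℝ U - B'.comp B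
  -- The first term solves `B ψ = r`. The second lies in the kernel of `B` and restores the control
  -- directions that `f` does not see.
  let ψ : X × U → U := fun q => B' (r q) + Q (M q.2)
  have hψ : ContDiffAt ℝ k ψ p :=
    (B'.contDiff.contDiffAt.fun_comp p hr).add
      ((Q.comp M).contDiff.contDiffAt.fun_comp p contDiffAt_snd)
  have hBQ : ∀ u, B (Q u) = 0 := fun u => by simp [Q, hBB]
  refine ⟨ψ, hψ, ?_, ?_⟩
  · filter_upwards [hmem] with q hq
    have : B (ψ q) = r q := by
      simp only [ψ, map_add, hBQ, add_zero]
      exact hB' _ hq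
    rw [this]
    simp [r]
  · have hrd := (hr.differentiableAt hk).hasFDerivAt
    have hψ' : HasFDerivAt ψ (B'.comp (fderiv ℝ r p) +
        (Q.comp M).comp (ContinuousLinearMap.snd ℝ X U)) p :=
      (B'.hasFDerivAt.comp p hrd).add ((Q.comp M).hasFDerivAt.comp p hasFDerivAt_snd)
    have hφd : HasFDerivAt φ (fderiv ℝ φ p.1) p.1 := (hφ.differentiableAt hk1).hasFDerivAt
    have hφ1 : HasFDerivAt (fun q : X × U => φ q.1)
        ((fderiv ℝ φ p.1).comp (ContinuousLinearMap.fst ℝ X U)) p :=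
      hφd.comp p hasFDerivAt_fst
    have hr0 : ∀ d, fderiv ℝ r p (0, d) = fderiv ℝ φ p.1 (fderiv ℝ f p (0, d)) := by
      intro d
      have h1 : HasFDerivAt (fun x => fderiv ℝ φ x) (fderiv ℝ (fderiv ℝ φ) p.1) p.1 :=
        ((hφ.fderiv_right hkk').differentiableAt hk).hasFDerivAt
      have h2 : HasFDerivAt (fun q : X × U => fderiv ℝ φ q.1)
        ((fderiv ℝ (fderiv ℝ φ) p.1).comp (ContinuousLinearMap.fst ℝ X U)) p :=
        h1.comp p hasFDerivAt_fst
      have h3 := (h2.clm_apply (hf.differentiableAt hk).hasFDerivAt).sub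
        (A.hasFDerivAt.comp p hφ1)
      have h4 : fderiv ℝ r p = _ := h3.fderiv
      rw [h4]
      simp
    -- Differentiating `B B' r = r` shows that the differential of `r` also has values in the range
    -- of `B`.
    have hrange : ∀ d, B (B' (fderiv ℝ r p d)) = fderiv ℝ r p d := by
      intro d
      have h1 : (fun q => B (B' (r q))) =ᶠ[𝓝 p] r := by
        filter_upwards [hmem] with q hq using hB' _ hq
      have h2 : HasFDerivAt (fun q => B (B' (r q))) ((B.comp B').comp (fderiv ℝ r p)) p :=
        (B.comp B').hasFDerivAt.comp p hrd
      have h3 := h2.unique (hrd.congr_of_eventuallyEq h1)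
      exact DFunLike.congr_fun h3 d
    have hinj : Function.Injective (((fderiv ℝ φ p.1).comp (ContinuousLinearMap.fst ℝ X U)).prod
        (B'.comp (fderiv ℝ r p) + (Q.comp M).comp (ContinuousLinearMap.snd ℝ X U))) := by
      rw [injective_iff_map_eq_zero]
      rintro ⟨dx, du⟩ h0
      have h1 : fderiv ℝ φ p.1 dx = 0 := congrArg Prod.fst h0
      have h2 : B' (fderiv ℝ r p (dx, du)) + Q (M du) = 0 := congrArg Prod.snd h0
      obtain rfl : dx = 0 := hφ' (by rw [h1, map_zero])
      have h3 : fderiv ℝ r p (0, du) = 0 := by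
        have := congrArg B h2
        rwa [map_add, hBQ, add_zero, map_zero, hrange] at this
      have h4 : fderiv ℝ f p (0, du) = 0 := hφ' (by rw [← hr0, h3, map_zero])
      have h5 : M du = 0 := by
        rw [h3, map_zero, zero_add] at h2
        simpa [Q, hker du h4] using h2
      obtain rfl : du = 0 := hM (by rw [h5, map_zero])
      rfl
    obtain ⟨e, he⟩ := exists_continuousLinearEquiv_of_injective hinj
    exact ⟨e, by rw [he]; exact hφ1.prodMk hψ'⟩

/-! ### Analytic frames and leaf coordinates. -/

/-- An analytic frame of the distribution which `φ` maps to the range of `B`, obtained from the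
values of the right-hand side at finitely many controls. -/
theorem exists_analytic_frame {A : X →L[ℝ] X} {B : U →L[ℝ] X} {f : X × U → X} {p : X × U}
    (hf : AnalyticAt ℝ f p) {φ : X → X} {ψ : X × U → U}
    (heq : ∀ᶠ q in 𝓝 p, fderiv ℝ φ q.1 (f q) = A (φ q.1) + B (ψ q))
    (hψ : 𝓝 (ψ p) ≤ Filter.map (fun u => ψ (p.1, u)) (𝓝 p.2)) :
    ∃ G : X → LinearMap.range (B : U →ₗ[ℝ] X) →L[ℝ] X, AnalyticAt ℝ G p.1 ∧
      (∀ w, fderiv ℝ φ p.1 (G p.1 w) = w) ∧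
      ∀ᶠ x in 𝓝 p.1, ∀ w, fderiv ℝ φ x (G x w) ∈ LinearMap.range (B : U →ₗ[ℝ] X) := by
  obtain ⟨s, hs, t, ht, hst⟩ := mem_nhds_prod_iff.1 (heq.and hf.eventually_analyticAt)
  let b := Module.finBasis ℝ (LinearMap.range (B : U →ₗ[ℝ] X))
  have hc : ∀ i, ∃ c : U, B c = b i := fun i => (b i).2
  choose c hc using hc
  -- Only openness of `ψ(p.1, ·)` at `p.2` is used, not differentiability; a control component that
  -- is merely a homeomorphism is therefore allowed.
  have hu : ∀ i, ∃ ε : ℝ, ε ≠ 0 ∧ ∃ u ∈ t, ψ (p.1, u) = ψ p + ε • c i := by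
    intro i
    have h1 : (fun u => ψ (p.1, u)) '' t ∈ 𝓝 (ψ p) := hψ (Filter.image_mem_map ht)
    have h2 : Filter.Tendsto (fun ε : ℝ => ψ p + ε • c i) (𝓝[≠] 0) (𝓝 (ψ p)) := by
      have : Continuous fun ε : ℝ => ψ p + ε • c i := by fun_prop
      have h := this.tendsto 0
      rw [zero_smul, add_zero] at h
      exact h.mono_left nhdsWithin_le_nhds
    obtain ⟨ε, h3, h4⟩ := ((h2.eventually h1).and self_mem_nhdsWithin).exists
    exact ⟨ε, h4, h3⟩
  choose ε hε u hut hu using hu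
  have hs' := mem_of_mem_nhds hs
  have ht' := mem_of_mem_nhds ht
  let cl : ∀ i, LinearMap.range (B : U →ₗ[ℝ] X) →L[ℝ] ℝ :=
    fun i => LinearMap.toContinuousLinearMap (b.coord i)
  let G : X → LinearMap.range (B : U →ₗ[ℝ] X) →L[ℝ] X := fun x =>
    ∑ i, ContinuousLinearMap.smulRightL ℝ _ X (cl i) ((ε i)⁻¹ • (f (x, u i) - f (x, p.2)))
  have hGx : ∀ x ∈ s, ∀ w, fderiv ℝ φ x (G x w) =
      ∑ i, b.coord i w • (ε i)⁻¹ • B (ψ (x, u i) - ψ (x, p.2)) := by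
    intro x hx w
    have h1 := fun i => (hst (Set.mk_mem_prod hx (hut i))).1
    have h2 := (hst (Set.mk_mem_prod hx ht')).1
    simp only at h1 h2
    have h3 : G x w = ∑ i, b.coord i w • (ε i)⁻¹ • (f (x, u i) - f (x, p.2)) := by
      simp only [G, cl, sum_apply, ContinuousLinearMap.smulRightL_apply_apply]
      rfl
    rw [h3]
    simp [h1, h2]
  refine ⟨G, ?_, ?_, ?_⟩
  · refine Finset.analyticAt_fun_sum _ fun i _ => ?_
    have h1 : ∀ v ∈ t, AnalyticAt ℝ (fun x => f (x, v)) p.1 := fun v hv =>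
      AnalyticAt.fun_comp (f := fun x => (x, v)) (hst (Set.mk_mem_prod hs' hv)).2
        (analyticAt_id.prod analyticAt_const)
    have h2 := ((h1 _ (hut i)).sub (h1 _ ht')).const_smul (c := (ε i)⁻¹)
    exact ((ContinuousLinearMap.smulRightL ℝ _ X (cl i)).analyticAt _).fun_comp h2
  · intro w
    rw [hGx _ hs']
    have h1 : ∀ i, b.coord i w • (ε i)⁻¹ • B (ψ (p.1, u i) - ψ (p.1, p.2)) =
        ((b.repr w i • b i : LinearMap.range (B : U →ₗ[ℝ] X)) : X) := by
      intro i
      rw [hu i, add_sub_cancel_left, map_smul, smul_smul (ε i)⁻¹, inv_mul_cancel₀ (hε i), one_smul,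
        hc i]
      rfl
    rw [Finset.sum_congr rfl fun i _ => h1 i, ← Submodule.coe_sum, b.sum_repr]
  · filter_upwards [hs] with x hx w
    rw [hGx x hx]
    exact Submodule.sum_mem _ fun i _ => Submodule.smul_mem _ _ (Submodule.smul_mem _ _ ⟨_, rfl⟩)

/-- Analytic coordinates `θ` whose first component `P φ = h ∘ fst ∘ θ` parametrizes the leaves of
the distribution which `φ` maps to `W`. -/
theorem exists_analytic_leaf_coordinates {X : Type} [NormedAddCommGroup X] [NormedSpace ℝ X]
    [FiniteDimensional ℝ X] {Y W : Submodule ℝ X} {J : (Y × W) ≃L[ℝ] X}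
    (hJ : ∀ y w, J (y, w) = (y : X) + w) {φ : X → X} {x₀ : X} (hφ : ContDiffAt ℝ 1 φ x₀)
    {L : X ≃L[ℝ] X}
    {G : X → W →L[ℝ] X} (hG : AnalyticAt ℝ G x₀) (hG₀ : ∀ w, L (G x₀ w) = w)
    (hGW : ∀ᶠ x in 𝓝 x₀, ∀ w, fderiv ℝ φ x (G x w) ∈ W) :
    ∃ ξ : Y × W → X, ContDiffAt ℝ ω ξ 0 ∧ ξ 0 = x₀ ∧
      HasFDerivAt ξ (((J.trans L.symm : (Y × W) ≃L[ℝ] X)) : Y × W →L[ℝ] X) 0 ∧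
      ∀ᶠ q in 𝓝 (0 : Y × W),
        (J.symm (φ (ξ q))).1 = (J.symm (φ (x₀ + L.symm (q.1 : X)))).1 := by
  obtain ⟨Ξ, hΞ, hΞ0, hΞ', hΞq⟩ := exists_analytic_flow hG
  -- `y` moves the initial point on a transversal and `w` flows it along the distribution.
  let α : Y × W → X × W := fun q => (x₀ + L.symm (q.1 : X), q.2)
  have hα0 : α 0 = (x₀, 0) := by simp [α]
  have hα : ContDiff ℝ ω α :=
    (contDiff_const.add (L.symm.contDiff.comp (Y.subtypeL.contDiff.comp contDiff_fst))).prodMk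
      contDiff_snd
  have hα' : HasFDerivAt α (((L.symm : X →L[ℝ] X).comp (Y.subtypeL.comp
      (ContinuousLinearMap.fst ℝ Y W))).prod (ContinuousLinearMap.snd ℝ Y W)) 0 :=
    (((L.symm : X →L[ℝ] X).comp (Y.subtypeL.comp
      (ContinuousLinearMap.fst ℝ Y W))).hasFDerivAt.const_add x₀).prodMk hasFDerivAt_snd
  rw [← hα0] at hΞ hΞ'
  refine ⟨fun q => Ξ (α q), ?_, (congrArg Ξ hα0).trans hΞ0, ?_, ?_⟩
  · exact ContDiffAt.fun_comp (0 : Y × W) hΞ.contDiffAt hα.contDiffAt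
  · refine (HasFDerivAt.comp (0 : Y × W) hΞ' hα').congr_fderiv ?_
    refine ContinuousLinearMap.ext fun d => L.injective ?_
    have : L (L.symm (d.1 : X) + G x₀ d.2) = L (L.symm (J d)) := by
      rw [map_add, hG₀, L.apply_symm_apply, L.apply_symm_apply, ← hJ]
    exact this
  · have hdiff : ∀ᶠ x in 𝓝 x₀, DifferentiableAt ℝ φ x :=
      (hφ.eventually (by simp)).mono fun x hx => hx.differentiableAt (by simp)
    let q₀ : X → Y := fun x => (J.symm (φ x)).1
    let PY : X →L[ℝ] Y := (ContinuousLinearMap.fst ℝ Y W).comp (J.symm : X →L[ℝ] Y × W)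
    have hPW : ∀ w ∈ W, PY w = 0 := by
      intro w hw
      have : J.symm w = (0, ⟨w, hw⟩) := by
        rw [ContinuousLinearEquiv.symm_apply_eq, hJ]; simp
      simp [PY, this]
    have h1 := hΞq q₀ (by
      filter_upwards [hdiff, hGW] with x hx hxW
      have h2 : HasFDerivAt q₀ (PY.comp (fderiv ℝ φ x)) x := PY.hasFDerivAt.comp x hx.hasFDerivAt
      refine ⟨h2.differentiableAt, fun w => ?_⟩
      rw [h2.fderiv]
      exact hPW _ (hxW w))
    have h3 : Filter.Tendsto α (𝓝 0) (𝓝 (x₀, 0)) := by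
      rw [← hα0]; exact hα.continuous.tendsto 0
    exact h3.eventually h1

theorem isCompl_prod_equiv {X : Type} [NormedAddCommGroup X] [NormedSpace ℝ X]
    [FiniteDimensional ℝ X] {Y W : Submodule ℝ X} (h : IsCompl Y W) :
    ∃ J : (Y × W) ≃L[ℝ] X, ∀ y w, J (y, w) = (y : X) + w :=
  ⟨(Submodule.prodEquivOfIsCompl Y W h).toContinuousLinearEquiv, fun y w => by
    change Submodule.prodEquivOfIsCompl Y W h (y, w) = _
    simp⟩

/-! ### Induction on the dimension of the state. -/

/-- If a controllable linearization of class `C¹` on the state exists, there is an analytic state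
transformation bringing the system to the form `A z` modulo the range of `B`. -/
theorem exists_analytic_state_transformation (N : ℕ) : ∀ (X U : Type) [NormedAddCommGroup X]
    [NormedSpace ℝ X] [FiniteDimensional ℝ X] [NormedAddCommGroup U] [NormedSpace ℝ U]
    [FiniteDimensional ℝ U] (_ : Module.finrank ℝ X < N) (A : X →L[ℝ] X) (B : U →L[ℝ] X)
    (_ : ∀ S : Submodule ℝ X, LinearMap.range (B : U →ₗ[ℝ] X) ≤ S → (∀ s ∈ S, A s ∈ S) → S = ⊤)
    (f : X × U → X) (p : X × U) (_ : AnalyticAt ℝ f p) (φ : X → X) (_ : ContDiffAt ℝ 1 φ p.1)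
    (_ : Function.Injective (fderiv ℝ φ p.1)) (ψ : X × U → U)
    (_ : ∀ᶠ q in 𝓝 p, fderiv ℝ φ q.1 (f q) = A (φ q.1) + B (ψ q))
    (_ : 𝓝 (ψ p) ≤ Filter.map (fun u => ψ (p.1, u)) (𝓝 p.2)),
    ∃ φ' : X → X, AnalyticAt ℝ φ' p.1 ∧ Function.Injective (fderiv ℝ φ' p.1) ∧
      ∀ᶠ q in 𝓝 p, fderiv ℝ φ' q.1 (f q) - A (φ' q.1) ∈ LinearMap.range (B : U →ₗ[ℝ] X) := by
  induction N with
  | zero => exact fun X U _ _ _ _ _ _ hN => absurd hN (Nat.not_lt_zero _)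
  | succ N ih =>
  intro X U _ _ _ _ _ _ hN A B hctrl f p hf φ hφ hφ' ψ heq hψ
  set W : Submodule ℝ X := LinearMap.range (B : U →ₗ[ℝ] X) with hW
  by_cases hX : Module.finrank ℝ X = 0
  · have : Subsingleton X := Module.finrank_zero_iff.1 hX
    refine ⟨id, analyticAt_id, Function.injective_of_subsingleton _, Filter.Eventually.of_forall
      fun q => ?_⟩
    rw [Subsingleton.elim (fderiv ℝ id q.1 (f q) - A (id q.1)) 0]
    exact Submodule.zero_mem _
  have hW0 : W ≠ ⊥ := by
    intro h0
    have h1 := hctrl ⊥ h0.le (fun s hs => by rw [(Submodule.mem_bot ℝ).1 hs]; simp)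
    apply hX
    have h2 := finrank_bot ℝ X
    rwa [h1, finrank_top] at h2
  obtain ⟨Y, hYW⟩ := Submodule.exists_isCompl W
  obtain ⟨J, hJ⟩ := isCompl_prod_equiv hYW.symm
  have hYN : Module.finrank ℝ Y < N := by
    have h1 := Submodule.finrank_add_eq_of_isCompl hYW
    have h2 : 0 < Module.finrank ℝ W :=
      Nat.pos_of_ne_zero fun h => hW0 (Submodule.finrank_eq_zero.1 h)
    omega
  obtain ⟨L, hL⟩ := exists_continuousLinearEquiv_of_injective hφ'
  have hφL : HasFDerivAt φ (L : X →L[ℝ] X) p.1 := by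
    rw [hL]; exact (hφ.differentiableAt (by simp)).hasFDerivAt
  obtain ⟨G, hG, hG0, hGW⟩ := exists_analytic_frame hf heq hψ
  have hG0' : ∀ w, L (G p.1 w) = w := fun w => by
    have := hG0 w
    rwa [← hL] at this
  obtain ⟨ξ, hξ, hξ0, hξ', hξφ⟩ := exists_analytic_leaf_coordinates hJ hφ hG hG0' hGW
  obtain ⟨θ, hθ, hθ0, hθ', hθξ, hξθ⟩ := exists_local_inverse (by simp) hξ0 hξ hξ'
  -- projections
  let PY : X →L[ℝ] Y := (ContinuousLinearMap.fst ℝ Y W).comp (J.symm : X →L[ℝ] Y × W)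
  let PW : X →L[ℝ] W := (ContinuousLinearMap.snd ℝ Y W).comp (J.symm : X →L[ℝ] Y × W)
  have hdec : ∀ z : X, (PY z : X) + PW z = z := fun z => by
    have := hJ (PY z) (PW z)
    rw [← this]
    exact J.apply_symm_apply z
  have hPYJ : ∀ q, PY (J q) = q.1 := fun q => by simp [PY]
  have hPWJ : ∀ q, PW (J q) = q.2 := fun q => by simp [PW]
  have hPYy : ∀ y : Y, PY y = y := fun y => by
    have := hPYJ (y, 0)
    rwa [hJ, Submodule.coe_zero, add_zero] at this
  have hPY0 : ∀ z, PY z = 0 ↔ z ∈ W := by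
    refine fun z => ⟨fun h => ?_, fun h => ?_⟩
    · have := hdec z
      rw [h, Submodule.coe_zero, zero_add] at this
      rw [← this]
      exact (PW z).2
    · have := hPYJ (0, ⟨z, h⟩)
      rwa [hJ, Submodule.coe_zero, zero_add] at this
  -- the reduced system
  let A₁ : Y →L[ℝ] Y := PY.comp (A.comp Y.subtypeL)
  let A₂ : W →L[ℝ] Y := PY.comp (A.comp W.subtypeL)
  have hA : ∀ z, PY (A z) = A₁ (PY z) + A₂ (PW z) := fun z => by
    have := congrArg (fun z => PY (A z)) (hdec z)
    simp only [map_add] at this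
    exact this.symm
  -- In leaf coordinates, `h` and `κ` are the `Y`- and `W`-parts of `φ`. The field `g` is the
  -- `y`-velocity of `f` with the control frozen at `p.2`; `w` becomes the new control.
  let h : Y → Y := fun y => PY (φ (p.1 + L.symm (y : X)))
  let κ : Y × W → W := fun q => PW (φ (ξ q))
  let g : Y × W → Y := fun q => (fderiv ℝ θ (ξ q) (f (ξ q, p.2))).1
  have hθ₀ : θ p.1 = 0 := hθ0
  have hLy : ContDiff ℝ ω (fun y : Y => p.1 + L.symm (y : X)) :=
    contDiff_const.add (L.symm.contDiff.comp Y.subtypeL.contDiff)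
  have hLy0 : p.1 + L.symm ((0 : Y) : X) = p.1 := by simp
  have hh : ContDiffAt ℝ 1 h 0 := by
    refine PY.contDiff.contDiffAt.fun_comp (0 : Y) (ContDiffAt.fun_comp (0 : Y) (g := φ) ?_
      (hLy.of_le le_top).contDiffAt)
    rwa [hLy0]
  have hh' : HasFDerivAt h (ContinuousLinearMap.id ℝ Y) 0 := by
    have h1 : HasFDerivAt (fun y : Y => p.1 + L.symm (y : X))
        ((L.symm : X →L[ℝ] X).comp Y.subtypeL) 0 :=
      ((L.symm : X →L[ℝ] X).comp Y.subtypeL).hasFDerivAt.const_add p.1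
    rw [← hLy0] at hφL
    refine (PY.hasFDerivAt.comp (0 : Y) (HasFDerivAt.comp (0 : Y) hφL h1)).congr_fderiv ?_
    refine ContinuousLinearMap.ext fun d => ?_
    have : PY (L (L.symm (d : X))) = d := by rw [L.apply_symm_apply, hPYy]
    exact this
  -- Injectivity near `0`, and not only at `0`, will show that the `y`-velocity does not depend on
  -- `u`.
  have hhinj : ∀ᶠ y in 𝓝 (0 : Y), Function.Injective (fderiv ℝ h y) := by
    have h1 : ContinuousAt (fderiv ℝ h) 0 :=
      (hh.fderiv_right (m := 0) (by simp)).continuousAt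
    have h2 : Set.range ((↑) : (Y ≃L[ℝ] Y) → Y →L[ℝ] Y) ∈ 𝓝 (fderiv ℝ h 0) := by
      rw [hh'.fderiv]
      exact ContinuousLinearEquiv.nhds (ContinuousLinearEquiv.refl ℝ Y)
    filter_upwards [h1.eventually h2] with y hy
    obtain ⟨e, he⟩ := hy
    rw [← he]
    exact e.injective
  have hθfst : Filter.Tendsto (fun x => (θ x).1) (𝓝 p.1) (𝓝 0) := by
    have := hθ.continuousAt.fst.tendsto
    simpa [hθ₀] using this
  have hθt : Filter.Tendsto θ (𝓝 p.1) (𝓝 0) := by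
    have := hθ.continuousAt.tendsto
    rwa [hθ₀] at this
  have hξt : Filter.Tendsto ξ (𝓝 0) (𝓝 p.1) := by
    have := hξ.continuousAt.tendsto
    rwa [hξ0] at this
  have hhθ : ∀ᶠ x in 𝓝 p.1, h (θ x).1 = PY (φ x) := by
    filter_upwards [hθt.eventually hξφ, hξθ] with x hx hx'
    rw [hx'] at hx
    exact hx.symm
  have hdφ : ∀ᶠ x in 𝓝 p.1, DifferentiableAt ℝ φ x :=
    (hφ.eventually (by simp)).mono fun x hx => hx.differentiableAt (by simp)
  have hdh : ∀ᶠ y in 𝓝 (0 : Y), DifferentiableAt ℝ h y :=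
    (hh.eventually (by simp)).mono fun x hx => hx.differentiableAt (by simp)
  have hdθ : ∀ᶠ x in 𝓝 p.1, DifferentiableAt ℝ θ x :=
    (hθ.eventually (by simp)).mono fun x hx => hx.differentiableAt (by simp)
  have hchain : ∀ᶠ x in 𝓝 p.1, ∀ v,
      fderiv ℝ h (θ x).1 (fderiv ℝ θ x v).1 = PY (fderiv ℝ φ x v) := by
    filter_upwards [hhθ.eventually_nhds, hdφ, hθfst.eventually hdh, hdθ] with x h1 h2 h3 h4 v
    have h5 : HasFDerivAt (fun x => h (θ x).1) _ x := HasFDerivAt.comp (g := h) x h3.hasFDerivAt h4.hasFDerivAt.fst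
    have h6 : HasFDerivAt (fun x => PY (φ x)) _ x := PY.hasFDerivAt.comp x h2.hasFDerivAt
    exact DFunLike.congr_fun (h5.unique (h6.congr_of_eventuallyEq h1)) v
  have hfst : Filter.Tendsto (fun q : X × U => q.1) (𝓝 p) (𝓝 p.1) := continuous_fst.tendsto p
  have hfield : ∀ᶠ q in 𝓝 p,
      fderiv ℝ h (θ q.1).1 (fderiv ℝ θ q.1 (f q)).1 = PY (A (φ q.1)) := by
    filter_upwards [hfst.eventually hchain, heq] with q h1 h2
    have h3 : PY (B (ψ q)) = 0 := (hPY0 _).2 ⟨ψ q, rfl⟩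
    rw [h1, h2, map_add, h3, add_zero]
  have hsec : Filter.Tendsto (fun x : X => (x, p.2)) (𝓝 p.1) (𝓝 p) :=
    (Continuous.prodMk_left p.2).tendsto p.1
  have hred : ∀ᶠ q in 𝓝 (0 : Y × W), fderiv ℝ h q.1 (g q) = A₁ (h q.1) + A₂ (κ q) := by
    filter_upwards [hξt.eventually (hsec.eventually hfield), hθξ, hξt.eventually hhθ]
      with q h1 h2 h3
    simp only [h2] at h1 h3
    rw [h3]
    exact h1.trans (hA _)
  have hg : AnalyticAt ℝ g 0 := by
    refine ContDiffAt.analyticAt ?_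
    have h1 : ContDiffAt ℝ ω (fun q => f (ξ q, p.2)) 0 := by
      refine ContDiffAt.fun_comp (0 : Y × W) (g := f) ?_ (hξ.prodMk contDiffAt_const)
      rw [hξ0]
      exact hf.contDiffAt
    have h2 : ContDiffAt ℝ ω (fun q => fderiv ℝ θ (ξ q)) 0 := by
      refine ContDiffAt.fun_comp (0 : Y × W) (g := fderiv ℝ θ) ?_ hξ
      rw [hξ0]
      exact hθ.fderiv_right (by simp)
    exact (h2.clm_apply h1).fst
  -- the control of the reduced system
  have hκs : HasStrictFDerivAt (fun w => κ (0, w))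
      ((ContinuousLinearEquiv.refl ℝ W : W ≃L[ℝ] W) : W →L[ℝ] W) 0 := by
    have h1 := hφ.hasStrictFDerivAt' hφL (by simp)
    have h2 := hξ.hasStrictFDerivAt' hξ' (by simp)
    have h3 : HasStrictFDerivAt (fun w : W => ((0, w) : Y × W)) (ContinuousLinearMap.inr ℝ Y W) 0 :=
      (ContinuousLinearMap.inr ℝ Y W).hasStrictFDerivAt
    rw [← hξ0] at h1
    have h4 := PW.hasStrictFDerivAt.comp (0 : W) (HasStrictFDerivAt.comp (0 : W) (g := φ ∘ ξ)
      (HasStrictFDerivAt.comp (0 : Y × W) (g := φ) h1 h2) h3)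
    refine h4.congr_fderiv ?_
    refine ContinuousLinearMap.ext fun d => ?_
    have : PW (L (L.symm (J (0, d)))) = d := by rw [L.apply_symm_apply, hPWJ]
    exact this
  have hκn : 𝓝 (κ 0) ≤ Filter.map (fun w => κ ((0 : Y × W).1, w)) (𝓝 (0 : Y × W).2) :=
    hκs.map_nhds_eq_of_equiv.ge
  -- The preimage of `S` under `PY` contains `W` and is invariant under `A`, so controllability
  -- passes to `(A₁, A₂)`.
  have hctrl' : ∀ S : Submodule ℝ Y, LinearMap.range (A₂ : W →ₗ[ℝ] Y) ≤ S →
      (∀ s ∈ S, A₁ s ∈ S) → S = ⊤ := by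
    intro S hS hAS
    have h1 := hctrl (S.comap (PY : X →ₗ[ℝ] Y)) (fun z hz => by
        change PY z ∈ S
        rw [(hPY0 z).2 hz]
        exact S.zero_mem) (fun z hz => by
        change PY (A z) ∈ S
        rw [hA]
        exact S.add_mem (hAS _ hz) (hS ⟨_, rfl⟩))
    refine eq_top_iff.2 fun y _ => ?_
    have h2 : (y : X) ∈ S.comap (PY : X →ₗ[ℝ] Y) := by rw [h1]; trivial
    have h3 : PY y ∈ S := h2
    rwa [hPYy] at h3
  have hhinj₀ : Function.Injective (fderiv ℝ h 0) := by
    rw [hh'.fderiv]; exact Function.injective_id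
  have hgθ : ∀ q, g q = (fderiv ℝ θ (ξ q) (f (ξ q, p.2))).1 := fun _ => rfl
  clear_value h κ g A₁ A₂
  obtain ⟨T₁, hT₁, hT₁inj, hT₁mem⟩ := ih Y W hYN A₁ A₂ hctrl' g 0 hg h hh hhinj₀ κ hred hκn
  obtain ⟨T₂, hT₂, hTeq, eT, heT⟩ := exists_control_transformation (k := ω) (k' := ω) (by simp)
    (by simp) hg.contDiffAt (hT₁.contDiffAt) hT₁inj hT₁mem (M := ContinuousLinearMap.id ℝ W)
    Function.injective_id (by
      intro d hd
      have h1 : HasFDerivAt (fun w : W => g (0, w))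
          ((fderiv ℝ g 0).comp (ContinuousLinearMap.inr ℝ Y W)) 0 :=
        HasFDerivAt.comp (0 : W) (g := g) hg.differentiableAt.hasFDerivAt
          (ContinuousLinearMap.inr ℝ Y W).hasFDerivAt
      have h2 : HasFDerivAt (fun w : W => fderiv ℝ h 0 (g (0, w))) _ 0 :=
        (fderiv ℝ h 0).hasFDerivAt.comp (0 : W) h1
      have h3 : HasFDerivAt (fun w : W => A₁ (h 0) + A₂ (κ (0, w))) _ 0 :=
        (A₂.hasFDerivAt.comp (0 : W) hκs.hasFDerivAt).const_add _
      have h4 : (fun w : W => fderiv ℝ h 0 (g (0, w))) =ᶠ[𝓝 0]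
          fun w => A₁ (h 0) + A₂ (κ (0, w)) :=
        ((Continuous.prodMk_right (0 : Y)).tendsto (0 : W)).eventually hred
      have h5 := DFunLike.congr_fun (h2.unique (h3.congr_of_eventuallyEq h4)) d
      have h6 : fderiv ℝ h 0 (fderiv ℝ g 0 (0, d)) = A₂ d := h5
      rw [hd, map_zero] at h6
      exact h6.symm)
  let φ' : X → X := fun x => J (T₁ (θ x).1, T₂ (θ x))
  have hT : ContDiffAt ℝ ω (fun q : Y × W => (T₁ q.1, T₂ q)) (θ p.1) := by
    rw [hθ₀]
    exact (ContDiffAt.fun_comp (0 : Y × W) hT₁.contDiffAt contDiffAt_fst).prodMk hT₂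
  have hφω : ContDiffAt ℝ ω φ' p.1 :=
    J.contDiff.contDiffAt.fun_comp p.1 (hT.fun_comp p.1 hθ)
  refine ⟨φ', hφω.analyticAt, ?_, ?_⟩
  · have h1 : HasFDerivAt φ' _ p.1 := J.hasFDerivAt.comp p.1
      (HasFDerivAt.comp p.1 (g := fun q : Y × W => (T₁ q.1, T₂ q)) (hθ₀.symm ▸ heT) hθ')
    rw [h1.fderiv]
    exact J.injective.comp (eT.injective.comp (ContinuousLinearEquiv.injective _))
  · have hdφ' : ∀ᶠ x in 𝓝 p.1, DifferentiableAt ℝ φ' x :=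
      (hφω.eventually (by simp)).mono fun x hx => hx.differentiableAt (by simp)
    have hdT : ∀ᶠ y in 𝓝 (0 : Y), DifferentiableAt ℝ T₁ y :=
      hT₁.eventually_analyticAt.mono fun y hy => hy.differentiableAt
    have hT₁' : ∀ᶠ x in 𝓝 p.1, ∀ v,
        PY (fderiv ℝ φ' x v) = fderiv ℝ T₁ (θ x).1 (fderiv ℝ θ x v).1 := by
      filter_upwards [hdφ', hθfst.eventually hdT, hdθ] with x h1 h2 h3 v
      have h4 : HasFDerivAt (fun x => T₁ (θ x).1) _ x := h2.hasFDerivAt.comp x h3.hasFDerivAt.fst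
      have h5 : HasFDerivAt (fun x => PY (φ' x)) _ x := PY.hasFDerivAt.comp x h1.hasFDerivAt
      have h6 : (fun x => PY (φ' x)) = fun x => T₁ (θ x).1 := by
        funext x
        exact hPYJ _
      rw [h6] at h5
      exact DFunLike.congr_fun (h5.unique h4) v
    filter_upwards [hfield, hfst.eventually (hsec.eventually hfield), hfst.eventually hT₁',
      hfst.eventually (hθt.eventually hTeq), hfst.eventually (hθfst.eventually hhinj),
      hfst.eventually hξθ] with q h1 h2 h3 h4 h5 h6
    -- The differential of `h` sends the `y`-velocities for the controls `q.2` and `p.2` to the same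
    -- `PY (A (φ q.1))`, and it is injective.
    have h7 : (fderiv ℝ θ q.1 (f q)).1 = g (θ q.1) := by
      have : g (θ q.1) = (fderiv ℝ θ q.1 (f (q.1, p.2))).1 := by rw [hgθ, h6]
      rw [this]
      exact h5 (h1.trans h2.symm)
    rw [← hPY0, map_sub, h3, h7, h4, hA, hPYJ, hPWJ, sub_self]

end ControlSystem

/-! ### Transport of solutions. -/

theorem LipschitzOnWith.comp_absolutelyContinuousOnInterval {V V' : Type*} [PseudoMetricSpace V]
    [PseudoMetricSpace V'] {K : NNReal} {φ : V → V'} {s : Set V} (hφ : LipschitzOnWith K φ s)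
    {c : ℝ → V} {a b : ℝ} (hc : AbsolutelyContinuousOnInterval c a b) (hs : MapsTo c (uIcc a b) s) :
    AbsolutelyContinuousOnInterval (fun t => φ (c t)) a b := by
  rw [absolutelyContinuousOnInterval_iff] at hc ⊢
  intro ε hε
  -- `K + 1` rather than `K`, which may vanish.
  obtain ⟨δ, hδ, h⟩ := hc (ε / (K + 1)) (by positivity)
  refine ⟨δ, hδ, fun E hE hEδ => ?_⟩
  calc ∑ i ∈ Finset.range E.1, dist (φ (c (E.2 i).1)) (φ (c (E.2 i).2))
      ≤ ∑ i ∈ Finset.range E.1, K * dist (c (E.2 i).1) (c (E.2 i).2) :=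
        Finset.sum_le_sum fun i hi =>
          hφ.dist_le_mul _ (hs (hE.1 i hi).1) _ (hs (hE.1 i hi).2)
    _ = K * ∑ i ∈ Finset.range E.1, dist (c (E.2 i).1) (c (E.2 i).2) :=
        (Finset.mul_sum _ _ _).symm
    _ ≤ K * (ε / (K + 1)) := by gcongr; exact (h E hE hEδ).le
    _ < (K + 1) * (ε / (K + 1)) := by gcongr; linarith
    _ = ε := by field_simp

namespace ControlSystem

variable {n m : ℕ}

/-- Needed because `χ.symm ∘ χ ∘ γ` is known to agree with `γ` only on `I`. -/
theorem IsSolution.congr {f : E n × E m → E n} {O : Set (E n × E m)} {I : Set ℝ}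
    (hI : I.OrdConnected) {γ γ' : ℝ → E n × E m} (h : IsSolution f O I γ) (he : EqOn γ γ' I) :
    IsSolution f O I γ' where
  mapsTo := h.mapsTo.congr he
  aemeasurable := h.aemeasurable.congr (ae_restrict_of_forall_mem hI.measurableSet he)
  locallyBounded := fun t ht => by
    obtain ⟨U, hU, hb⟩ := h.locallyBounded t ht
    refine ⟨U ∩ I, Filter.inter_mem hU self_mem_nhdsWithin, ?_⟩
    rw [← (he.mono inter_subset_right).image_eq]
    exact hb.subset (image_mono inter_subset_left)
  absolutelyContinuous := fun a ha b hb hab => by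
    have h1 := h.absolutelyContinuous a ha b hb hab
    rw [absolutelyContinuousOnInterval_iff] at h1 ⊢
    intro ε hε
    obtain ⟨δ, hδ, h2⟩ := h1 ε hε
    refine ⟨δ, hδ, fun E hE hEδ => ?_⟩
    refine lt_of_eq_of_lt (Finset.sum_congr rfl fun i hi => ?_) (h2 E hE hEδ)
    have hsub : uIcc a b ⊆ I := by rw [uIcc_of_le hab]; exact hI.out ha hb
    rw [he (hsub (hE.1 i hi).1), he (hsub (hE.1 i hi).2)]
  integrable := fun a ha b hb hab => by
    refine (h.integrable a ha b hb hab).congr fun t ht => ?_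
    rw [uIoc_of_le hab] at ht
    rw [he (hI.out ha hb (Ioc_subset_Icc_self ht))]
  integral_eq := fun a ha b hb hab => by
    rw [← he ha, ← he hb, h.integral_eq a ha b hb hab]
    refine intervalIntegral.integral_congr fun t ht => ?_
    rw [uIcc_of_le hab] at ht
    rw [he (hI.out ha hb ht)]

theorem IsSolution.mono {f : E n × E m → E n} {O O' : Set (E n × E m)} {I : Set ℝ}
    {γ : ℝ → E n × E m} (h : IsSolution f O I γ) (hγ : MapsTo γ I O') : IsSolution f O' I γ :=
  { h with mapsTo := hγ }

/-- Solutions are transported by triangular maps which satisfy the conjugacy equation. -/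
theorem IsSolution.map {f g : E n × E m → E n} {O O' : Set (E n × E m)}
    {χ : E n × E m → E n × E m} {φ : E n → E n} {K : NNReal} (hO : MeasurableSet O)
    (hχc : ContinuousOn χ O) (hχ : MapsTo χ O O') (hO' : Bornology.IsBounded O')
    (hO'm : MeasurableSet O') (hφ : ∀ q ∈ O, (χ q).1 = φ q.1)
    (hφK : LipschitzOnWith K φ (Prod.fst '' O)) (hφd : ∀ q ∈ O, DifferentiableAt ℝ φ q.1)
    (hg : ContinuousOn g O') (hgb : Bornology.IsBounded (g '' O'))
    (heq : ∀ q ∈ O, fderiv ℝ φ q.1 (f q) = g (χ q)) {I : Set ℝ} (hI : I.OrdConnected)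
    {γ : ℝ → E n × E m} (hγ : IsSolution f O I γ) : IsSolution g O' I (χ ∘ γ) := by
  classical
  have hmaps : MapsTo (χ ∘ γ) I O' := hχ.comp hγ.mapsTo
  have hmeas : AEMeasurable (χ ∘ γ) (volume.restrict I) := by
    have h1 : Measurable (O.piecewise χ fun _ => 0) :=
      hχc.measurable_piecewise continuousOn_const hO
    refine (h1.comp_aemeasurable hγ.aemeasurable).congr
      (ae_restrict_of_forall_mem hI.measurableSet fun t ht => ?_)
    exact piecewise_eq_of_mem _ _ _ (hγ.mapsTo ht)
  obtain ⟨C, hC⟩ := hgb.exists_norm_le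
  have hCt : ∀ t ∈ I, ‖g (χ (γ t))‖ ≤ C := fun t ht => hC _ (mem_image_of_mem g (hmaps ht))
  have hgm : AEMeasurable (fun t => g (χ (γ t))) (volume.restrict I) := by
    have h1 : Measurable (O'.piecewise g fun _ => 0) :=
      hg.measurable_piecewise continuousOn_const hO'm
    refine (h1.comp_aemeasurable hmeas).congr
      (ae_restrict_of_forall_mem hI.measurableSet fun t ht => ?_)
    exact piecewise_eq_of_mem _ _ _ (hmaps ht)
  have hint : ∀ a ∈ I, ∀ b ∈ I, a ≤ b →
      IntervalIntegrable (fun t => g (χ (γ t))) volume a b := by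
    intro a ha b hb hab
    have hsub : Ioc a b ⊆ I := Ioc_subset_Icc_self.trans (hI.out ha hb)
    rw [intervalIntegrable_iff_integrableOn_Ioc_of_le hab]
    refine IntegrableOn.of_bound (by simp) (hgm.mono_set hsub).aestronglyMeasurable C ?_
    exact ae_restrict_of_forall_mem measurableSet_Ioc fun t ht => hCt t (hsub ht)
  have hfst : ∀ t ∈ I, ((χ ∘ γ) t).1 = φ (γ t).1 := fun t ht => hφ _ (hγ.mapsTo ht)
  have hac : ∀ a ∈ I, ∀ b ∈ I, a ≤ b →
      AbsolutelyContinuousOnInterval (fun t => φ (γ t).1) a b := by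
    intro a ha b hb hab
    refine hφK.comp_absolutelyContinuousOnInterval (hγ.absolutelyContinuous a ha b hb hab) ?_
    intro t ht
    rw [uIcc_of_le hab] at ht
    exact mem_image_of_mem _ (hγ.mapsTo (hI.out ha hb ht))
  refine ⟨hmaps, hmeas, fun t _ => ⟨I, self_mem_nhdsWithin, hO'.subset hmaps.image_subset⟩, ?_,
    hint, ?_⟩
  · intro a ha b hb hab
    have h1 := hac a ha b hb hab
    rw [absolutelyContinuousOnInterval_iff] at h1 ⊢
    intro ε hε
    obtain ⟨δ, hδ, h2⟩ := h1 ε hε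
    refine ⟨δ, hδ, fun E hE hEδ => ?_⟩
    refine lt_of_eq_of_lt (Finset.sum_congr rfl fun i hi => ?_) (h2 E hE hEδ)
    have hsub : uIcc a b ⊆ I := by rw [uIcc_of_le hab]; exact hI.out ha hb
    rw [hfst _ (hsub (hE.1 i hi).1), hfst _ (hsub (hE.1 i hi).2)]
  · intro a ha b hb hab
    have hsub : uIcc a b ⊆ I := by rw [uIcc_of_le hab]; exact hI.out ha hb
    have hgi := hint a ha b hb hab
    have hfi := hγ.integrable a ha b hb hab
    have hlip : LipschitzOnWith C.toNNReal (fun t => ∫ s in a..t, g (χ (γ s))) (uIcc a b) := by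
      refine LipschitzOnWith.of_dist_le_mul fun x hx y hy => ?_
      have hix : ∀ z ∈ uIcc a b, IntervalIntegrable (fun t => g (χ (γ t))) volume a z :=
        fun z hz => hgi.mono_set (uIcc_subset_uIcc left_mem_uIcc hz)
      rw [dist_eq_norm, intervalIntegral.integral_interval_sub_left (hix x hx) (hix y hy)]
      refine (intervalIntegral.norm_integral_le_of_norm_le_const (C := C) fun t ht => ?_).trans ?_
      · exact hCt t (hsub (uIcc_subset_uIcc hy hx (uIoc_subset_uIcc ht)))
      · rw [Real.dist_eq]
        gcongr
        exact Real.le_coe_toNNReal C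
    -- The difference between the transported state and the integral of `g` is absolutely
    -- continuous; by Lebesgue differentiation and the chain rule its derivative vanishes almost
    -- everywhere.
    have hF := (hac a ha b hb hab).sub hlip.absolutelyContinuousOnInterval
    obtain ⟨c, hc⟩ := hF.const_of_ae_hasDerivAt_zero (by
      have hne : ∀ z : ℝ, ∀ᵐ x, x ≠ z := fun z => by simp [ae_iff, measure_singleton]
      filter_upwards [hgi.ae_hasDerivAt_integral, hfi.ae_hasDerivAt_integral, hne a, hne b]
        with x h1 h2 hxa hxb hx
      have h3 := h1 hx a left_mem_uIcc
      have h4 := h2 hx a left_mem_uIcc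
      have hxI := hsub hx
      have hx' : x ∈ Ioo a b := by
        rw [uIcc_of_le hab] at hx
        exact ⟨lt_of_le_of_ne hx.1 (Ne.symm hxa), lt_of_le_of_ne hx.2 hxb⟩
      have h5 : HasDerivAt (fun t => (γ t).1) (f (γ x)) x := by
        refine (h4.const_add (γ a).1).congr_of_eventuallyEq ?_
        filter_upwards [Ioo_mem_nhds hx'.1 hx'.2] with t ht
        rw [← hγ.integral_eq a ha t (hI.out ha hb (Ioo_subset_Icc_self ht)) ht.1.le]
        abel
      have h6 := (hφd _ (hγ.mapsTo hxI)).hasFDerivAt.comp_hasDerivAt x h5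
      rw [heq _ (hγ.mapsTo hxI)] at h6
      have h7 := h6.sub h3
      rw [sub_self] at h7
      exact h7)
    have h1 := hc a left_mem_uIcc
    have h2 := hc b right_mem_uIcc
    simp only [Pi.sub_apply, intervalIntegral.integral_same, sub_zero] at h1 h2
    rw [hfst a ha, hfst b hb, h1, ← h2]
    simp

/-! ### Trajectories with constant control. -/

/-- Near a point where the right-hand side is regular, a conjugacy has a state component that does
not depend on the control and satisfies the conjugacy equation. -/
theorem Conjugates.hasDerivAt {f g : E n × E m → E n}
    {χ : OpenPartialHomeomorph (E n × E m) (E n × E m)} (h : Conjugates f g χ) (hg : Continuous g)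
    {q : E n × E m} (hq : q ∈ χ.source) (hf : AnalyticAt ℝ f q) :
    (∃ α : ℝ → E n, α 0 = q.1 ∧ HasDerivAt α (f q) 0 ∧
      HasDerivAt (fun t => (χ (α t, q.2)).1) (g (χ q)) 0) ∧
    ∀ u, (q.1, u) ∈ χ.source → (χ (q.1, u)).1 = (χ q).1 := by
  have hf1 : ContDiffAt ℝ 1 (fun x => f (x, q.2)) q.1 :=
    ContDiffAt.fun_comp q.1 (g := f) hf.contDiffAt (contDiffAt_id.prodMk contDiffAt_const)
  obtain ⟨α, hα0, ε, hε, hα⟩ :=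
    hf1.exists_forall_mem_closedBall_exists_eq_forall_mem_Ioo_hasDerivAt₀ 0
  have hαc : ContinuousAt α 0 := (hα 0 (by simp [hε])).continuousAt
  have hgood : ∀ᶠ t in 𝓝 (0 : ℝ), (α t, q.2) ∈ χ.source ∧ ContinuousAt f (α t, q.2) := by
    have h1 : Filter.Tendsto (fun t => (α t, q.2)) (𝓝 0) (𝓝 q) := by
      have : ContinuousAt (fun t => (α t, q.2)) 0 := hαc.prodMk continuousAt_const
      have h2 := this.tendsto
      rwa [hα0] at h2
    exact h1.eventually ((χ.open_source.eventually_mem hq).and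
      (hf.eventually_analyticAt.mono fun x hx => hx.continuousAt))
  obtain ⟨δ, hδ, hball⟩ := Metric.eventually_nhds_iff_ball.1 hgood
  set r := min ε δ with hr
  have hr0 : 0 < r := lt_min hε hδ
  let I := Ioo (-r) r
  have hI : I.OrdConnected := ordConnected_Ioo
  have h0I : (0 : ℝ) ∈ I := ⟨by linarith, hr0⟩
  have hαd : ∀ t ∈ I, HasDerivAt α (f (α t, q.2)) t := fun t ht => hα t
    ⟨by rw [zero_sub]; linarith [ht.1, min_le_left ε δ], by
      rw [zero_add]; exact lt_of_lt_of_le ht.2 (min_le_left ε δ)⟩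
  have hIs : ∀ t ∈ I, (α t, q.2) ∈ χ.source ∧ ContinuousAt f (α t, q.2) := fun t ht =>
    hball t (by
      rw [Metric.mem_ball, Real.dist_eq, sub_zero, abs_lt]
      exact ⟨by linarith [ht.1, min_le_right ε δ], lt_of_lt_of_le ht.2 (min_le_right ε δ)⟩)
  let γ : ℝ → E n × E m := fun t => (α t, q.2)
  have hγc : ∀ t ∈ I, ContinuousAt γ t := fun t ht =>
    (hαd t ht).continuousAt.prodMk continuousAt_const
  have hfγ : ∀ t ∈ I, ContinuousAt (fun t => f (γ t)) t := fun t ht =>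
    ContinuousAt.comp (g := f) (hIs t ht).2 (hγc t ht)
  have hsub : ∀ a ∈ I, ∀ b ∈ I, a ≤ b → uIcc a b ⊆ I := fun a ha b hb hab => by
    rw [uIcc_of_le hab]; exact hI.out ha hb
  have hint : ∀ a ∈ I, ∀ b ∈ I, a ≤ b → IntervalIntegrable (fun t => f (γ t)) volume a b :=
    fun a ha b hb hab => ContinuousOn.intervalIntegrable fun t ht =>
      (hfγ t (hsub a ha b hb hab ht)).continuousWithinAt
  have hsol : IsSolution f χ.source I γ := by
    refine ⟨fun t ht => (hIs t ht).1, ?_, ?_, ?_, hint, ?_⟩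
    · exact ContinuousOn.aemeasurable (fun t ht => (hγc t ht).continuousWithinAt)
        measurableSet_Ioo
    · intro t ht
      refine ⟨γ ⁻¹' Metric.ball (γ t) 1, (hγc t ht).continuousWithinAt
        (Metric.ball_mem_nhds _ one_pos), Metric.isBounded_ball.subset (image_preimage_subset _ _)⟩
    · intro a ha b hb hab
      have hcont : ContinuousOn (fun t => f (γ t)) (uIcc a b) := fun t ht =>
        (hfγ t (hsub a ha b hb hab ht)).continuousWithinAt
      obtain ⟨C, hC⟩ := isCompact_uIcc.exists_bound_of_continuousOn hcont
      refine LipschitzOnWith.absolutelyContinuousOnInterval (K := C.toNNReal) ?_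
      refine (convex_uIcc a b).lipschitzOnWith_of_nnnorm_hasDerivWithin_le
        (f' := fun t => f (γ t)) (fun t ht => (hαd t (hsub a ha b hb hab ht)).hasDerivWithinAt)
        fun t ht => ?_
      rw [← NNReal.coe_le_coe, coe_nnnorm]
      exact (hC t ht).trans (Real.le_coe_toNNReal C)
    · intro a ha b hb hab
      exact (intervalIntegral.integral_eq_sub_of_hasDerivAt
        (fun t ht => hαd t (hsub a ha b hb hab ht)) (hint a ha b hb hab)).symm
  have hχsol := (h I γ hI hsol.mapsTo).1 hsol
  have hχγ : ∀ t ∈ I, ContinuousAt (fun t => χ (γ t)) t := fun t ht =>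
    ContinuousAt.comp (f := γ) (g := χ) (χ.continuousAt (hIs t ht).1) (hγc t ht)
  have hγ0 : γ 0 = q := by simp [γ, hα0]
  refine ⟨⟨α, hα0, ?_, ?_⟩, ?_⟩
  · have := hαd 0 h0I
    rwa [hα0] at this
  · have hgc : ∀ t ∈ I, ContinuousAt (fun t => g (χ (γ t))) t := fun t ht =>
      hg.continuousAt.comp (hχγ t ht)
    -- A base point to the left of `0` makes the integral identity available on both sides of `0`.
    let z := -(r / 2)
    have hz : z ∈ I := ⟨by simp only [z]; linarith, by simp only [z]; linarith⟩
    have hz0 : z < 0 := by simp only [z]; linarith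
    have h1 : HasDerivAt (fun t => ∫ s in z..t, g (χ (γ s))) (g (χ (γ 0))) 0 := by
      refine intervalIntegral.integral_hasDerivAt_right
        (hχsol.integrable z hz 0 h0I hz0.le) ?_ (hgc 0 h0I)
      exact ContinuousOn.stronglyMeasurableAtFilter isOpen_Ioo
        (fun t ht => (hgc t ht).continuousWithinAt) 0 h0I
    rw [hγ0] at h1
    refine (h1.const_add (χ (γ z)).1).congr_of_eventuallyEq ?_
    filter_upwards [Ioo_mem_nhds hz0 hr0] with t ht
    have h2 := hχsol.integral_eq z hz t ⟨by linarith [ht.1, hz.1], ht.2⟩ ht.1.le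
    have h3 : (χ (γ t)).1 - (χ (γ z)).1 = ∫ s in z..t, g (χ (γ s)) := h2
    rw [← h3]
    abel
  · intro u hu
    -- The control takes the value `u` at time `0` only. The image state is continuous and unchanged
    -- at all other times, hence unchanged at `0`.
    let γ' : ℝ → E n × E m := Function.update γ 0 (q.1, u)
    have hne : ∀ t, t ≠ 0 → γ' t = γ t := fun t ht => Function.update_of_ne ht _ _
    have h00 : γ' 0 = (q.1, u) := Function.update_self _ _ _
    have hfst : ∀ t, (γ' t).1 = (γ t).1 := fun t => by
      by_cases ht : t = 0
      · subst ht; rw [h00, hγ0]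
      · rw [hne t ht]
    have hae : γ =ᵐ[volume] γ' := by
      have : ∀ᵐ t : ℝ, t ≠ 0 := by simp [ae_iff, measure_singleton]
      filter_upwards [this] with t ht using (hne t ht).symm
    have hfae : (fun t => f (γ t)) =ᵐ[volume] fun t => f (γ' t) :=
      hae.mono fun t ht => by simp only [ht]
    have hsol' : IsSolution f χ.source I γ' := by
      refine ⟨fun t ht => ?_, hsol.aemeasurable.congr (ae_restrict_of_ae hae), fun t ht => ?_,
        fun a ha b hb hab => ?_, fun a ha b hb hab => ?_, fun a ha b hb hab => ?_⟩
      · by_cases h0 : t = 0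
        · subst h0; rw [h00]; exact hu
        · rw [hne t h0]; exact hsol.mapsTo ht
      · obtain ⟨U, hU, hb⟩ := hsol.locallyBounded t ht
        refine ⟨U, hU, (hb.union (Bornology.isBounded_singleton (x := (q.1, u)))).subset ?_⟩
        rintro _ ⟨s, hs, rfl⟩
        by_cases h0 : s = 0
        · right; subst h0; exact h00
        · left; exact ⟨s, hs, (hne s h0).symm⟩
      · simp only [hfst]
        exact hsol.absolutelyContinuous a ha b hb hab
      · exact (hint a ha b hb hab).congr_ae (ae_restrict_of_ae hfae)
      · rw [hfst, hfst, hsol.integral_eq a ha b hb hab]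
        exact intervalIntegral.integral_congr_ae (hfae.mono fun t ht _ => ht)
    have hχsol' := (h I γ' hI hsol'.mapsTo).1 hsol'
    let z := -(r / 2)
    let z' := r / 2
    have hz : z ∈ I := ⟨by simp only [z]; linarith, by simp only [z]; linarith⟩
    have hz' : z' ∈ I := ⟨by simp only [z']; linarith, by simp only [z']; linarith⟩
    have hc' : ContinuousAt (fun t => (χ (γ' t)).1) 0 := by
      have := (hχsol'.absolutelyContinuous z hz z' hz'
        (by simp only [z, z']; linarith)).continuousOn
      refine this.continuousAt ?_
      rw [uIcc_of_le (by simp only [z, z']; linarith)]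
      exact Icc_mem_nhds (by simp only [z]; linarith) (by simp only [z']; linarith)
    have hc : ContinuousAt (fun t => (χ (γ t)).1) 0 := (hχγ 0 h0I).fst
    have hev : (fun t => (χ (γ' t)).1) =ᶠ[𝓝[≠] 0] fun t => (χ (γ t)).1 := by
      filter_upwards [self_mem_nhdsWithin] with t ht
      rw [hne t ht]
    have h1 := hc'.tendsto.mono_left (nhdsWithin_le_nhds (s := {0}ᶜ))
    have h2 := hc.tendsto.mono_left (nhdsWithin_le_nhds (s := {0}ᶜ))
    have h3 := tendsto_nhds_unique (h1.congr' hev) h2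
    rwa [h00, hγ0] at h3

/-! ### Linear systems and controllability. -/

/-- Matrices as continuous linear maps between Euclidean spaces. -/
noncomputable def matrixCLM {k l : ℕ} (M : Matrix (Fin k) (Fin l) ℝ) : E l →L[ℝ] E k :=
  LinearMap.toContinuousLinearMap
    { toFun := fun v => WithLp.toLp 2 (M *ᵥ v.ofLp)
      map_add' := fun v w => by simp [Matrix.mulVec_add]
      map_smul' := fun c v => by simp [Matrix.mulVec_smul] }

theorem matrixCLM_apply {k l : ℕ} (M : Matrix (Fin k) (Fin l) ℝ) (v : E l) :
    matrixCLM M v = WithLp.toLp 2 (M *ᵥ v.ofLp) := rfl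

theorem linearSystem_apply (A : Matrix (Fin n) (Fin n) ℝ) (B : Matrix (Fin n) (Fin m) ℝ)
    (q : E n × E m) : linearSystem A B q = matrixCLM A q.1 + matrixCLM B q.2 := rfl

theorem linearSystem_eq_coprod (A : Matrix (Fin n) (Fin n) ℝ) (B : Matrix (Fin n) (Fin m) ℝ) :
    linearSystem A B = (matrixCLM A).coprod (matrixCLM B) := by
  funext q
  rw [linearSystem_apply, ContinuousLinearMap.coprod_apply]

theorem continuous_linearSystem (A : Matrix (Fin n) (Fin n) ℝ) (B : Matrix (Fin n) (Fin m) ℝ) :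
    Continuous (linearSystem A B) := by
  rw [linearSystem_eq_coprod]
  exact ContinuousLinearMap.continuous _

/-- For a controllable pair, the only invariant subspace containing the range of `B` is `⊤`. -/
theorem IsControllable.eq_top {A : Matrix (Fin n) (Fin n) ℝ} {B : Matrix (Fin n) (Fin m) ℝ}
    (h : IsControllable A B) (S : Submodule ℝ (E n))
    (hB : LinearMap.range (matrixCLM B : E m →ₗ[ℝ] E n) ≤ S) (hA : ∀ s ∈ S, matrixCLM A s ∈ S) :
    S = ⊤ := by
  have hcol : ∀ (k : ℕ) (j : Fin m), WithLp.toLp 2 ((A ^ k * B).col j) ∈ S := by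
    intro k
    induction k with
    | zero =>
      intro j
      refine hB ⟨WithLp.toLp 2 (Pi.single j 1), ?_⟩
      change WithLp.toLp 2 (B *ᵥ Pi.single j 1) = _
      rw [Matrix.mulVec_single_one, pow_zero, Matrix.one_mul]
    | succ k ih =>
      intro j
      have h1 := hA _ (ih j)
      rw [matrixCLM_apply] at h1
      have h2 : (A ^ (k + 1) * B).col j = A *ᵥ (A ^ k * B).col j := by
        rw [pow_succ', Matrix.mul_assoc]
        rfl
      rwa [h2]
  have hrange : LinearMap.range (kalmanMatrix A B).mulVecLin = ⊤ := by
    refine Submodule.eq_top_of_finrank_eq ?_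
    rw [Module.finrank_fin_fun]
    exact h
  refine eq_top_iff.2 fun z _ => ?_
  obtain ⟨c, hc⟩ : z.ofLp ∈ LinearMap.range (kalmanMatrix A B).mulVecLin := by
    rw [hrange]; trivial
  have hz : z = ∑ j, c j • WithLp.toLp 2 ((A ^ (j.1 : ℕ) * B).col j.2) := by
    ext i
    rw [← hc]
    simp [kalmanMatrix, Matrix.mulVec, dotProduct, mul_comm]
  rw [hz]
  exact Submodule.sum_mem _ fun j _ => S.smul_mem _ (hcol _ _)

/-! ### Consequences of conjugacy. -/

/-- The conjugacy equation. -/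
theorem Conjugates.fderiv_eq {f g : E n × E m → E n}
    {χ : OpenPartialHomeomorph (E n × E m) (E n × E m)} (h : Conjugates f g χ) (hg : Continuous g)
    {q : E n × E m} (hq : q ∈ χ.source) (hf : AnalyticAt ℝ f q) {φ : E n → E n}
    (hφ : DifferentiableAt ℝ φ q.1) (hχφ : ∀ᶠ r in 𝓝 q, (χ r).1 = φ r.1) :
    fderiv ℝ φ q.1 (f q) = g (χ q) := by
  obtain ⟨⟨α, hα0, hα, hχα⟩, -⟩ := h.hasDerivAt hg hq hf
  have h1 : HasDerivAt (fun t => φ (α t)) (fderiv ℝ φ q.1 (f q)) 0 := by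
    have h2 : HasFDerivAt φ (fderiv ℝ φ q.1) (α 0) := by rw [hα0]; exact hφ.hasFDerivAt
    exact h2.comp_hasDerivAt (0 : ℝ) hα
  have h3 : Filter.Tendsto (fun t => (α t, q.2)) (𝓝 0) (𝓝 q) := by
    have h4 : ContinuousAt (fun t => (α t, q.2)) 0 := hα.continuousAt.prodMk continuousAt_const
    have := h4.tendsto
    rwa [hα0] at this
  exact (h1.congr_of_eventuallyEq (h3.eventually hχφ)).unique hχα

/-- For `v` near `(χ p).2`, the point `χ.symm ((χ p).1, v)` has state `p.1` because `φ` is injective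
at `p.1`; its control is a preimage of `v`, close to `p.2` by continuity of `χ.symm`. -/
theorem nhds_le_map_control {χ : OpenPartialHomeomorph (E n × E m) (E n × E m)} {p : E n × E m}
    (hp : p ∈ χ.source) {φ : E n → E n} (hinj : ∀ᶠ x in 𝓝 p.1, φ x = φ p.1 → x = p.1)
    (hχφ : ∀ᶠ q in 𝓝 p, (χ q).1 = φ q.1) :
    𝓝 (χ p).2 ≤ Filter.map (fun u => (χ (p.1, u)).2) (𝓝 p.2) := by
  intro s hs
  have hs' : ∀ᶠ u in 𝓝 p.2, (χ (p.1, u)).2 ∈ s := hs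
  have ht : Filter.Tendsto (fun v => ((χ p).1, v)) (𝓝 (χ p).2) (𝓝 (χ p)) :=
    (Continuous.prodMk_right (χ p).1).tendsto (χ p).2
  have hsymm : Filter.Tendsto (fun v => χ.symm ((χ p).1, v)) (𝓝 (χ p).2) (𝓝 p) := by
    have h1 := (χ.continuousAt_symm (χ.map_source hp)).tendsto
    rw [χ.left_inv hp] at h1
    exact h1.comp ht
  filter_upwards [ht.eventually (χ.open_target.eventually_mem (χ.map_source hp)),
    hsymm.eventually hχφ, (continuous_fst.tendsto p).comp hsymm |>.eventually hinj,
    (continuous_snd.tendsto p).comp hsymm |>.eventually hs'] with v h1 h2 h3 h4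
  have h5 := χ.right_inv h1
  have h6 : (χ.symm ((χ p).1, v)).1 = p.1 := by
    refine h3 ?_
    have : φ (χ.symm ((χ p).1, v)).1 = (χ p).1 := by rw [← h2, h5]
    exact this.trans hχφ.self_of_nhds
  have h7 : (p.1, (χ.symm ((χ p).1, v)).2) = χ.symm ((χ p).1, v) := by rw [← h6]
  have h8 : (χ (p.1, (χ.symm ((χ p).1, v)).2)).2 ∈ s := h4
  rwa [h7, h5] at h8

/-- A conjugacy to a controllable linear system whose state component is of class `C¹` yields an
analytic state transformation. -/
theorem Conjugates.exists_analytic_state_transformation {f : E n × E m → E n}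
    {A : Matrix (Fin n) (Fin n) ℝ} {B : Matrix (Fin n) (Fin m) ℝ} (hAB : IsControllable A B)
    {χ : OpenPartialHomeomorph (E n × E m) (E n × E m)} (h : Conjugates f (linearSystem A B) χ)
    {p : E n × E m} (hp : p ∈ χ.source) (hf : AnalyticAt ℝ f p) {φ : E n → E n}
    (hφ : ContDiffAt ℝ 1 φ p.1) (hφ' : Function.Injective (fderiv ℝ φ p.1))
    (hχφ : ∀ᶠ q in 𝓝 p, (χ q).1 = φ q.1) :
    (∀ᶠ q in 𝓝 p, fderiv ℝ φ q.1 (f q) = matrixCLM A (φ q.1) + matrixCLM B (χ q).2) ∧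
    ∃ φ' : E n → E n, AnalyticAt ℝ φ' p.1 ∧ Function.Injective (fderiv ℝ φ' p.1) ∧
      ∀ᶠ q in 𝓝 p, fderiv ℝ φ' q.1 (f q) - matrixCLM A (φ' q.1) ∈
        LinearMap.range (matrixCLM B : E m →ₗ[ℝ] E n) := by
  have heq : ∀ᶠ q in 𝓝 p,
      fderiv ℝ φ q.1 (f q) = matrixCLM A (φ q.1) + matrixCLM B (χ q).2 := by
    have hd : ∀ᶠ x in 𝓝 p.1, DifferentiableAt ℝ φ x :=
      (hφ.eventually (by simp)).mono fun x hx => hx.differentiableAt (by simp)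
    filter_upwards [χ.open_source.eventually_mem hp, hf.eventually_analyticAt,
      (continuous_fst.tendsto p).eventually hd, hχφ.eventually_nhds] with q h1 h2 h3 h4
    rw [h.fderiv_eq (continuous_linearSystem A B) h1 h2 h3 h4, linearSystem_apply,
      h4.self_of_nhds]
  refine ⟨heq, ?_⟩
  obtain ⟨L, hL⟩ := exists_continuousLinearEquiv_of_injective hφ'
  obtain ⟨θ, -, -, -, hθ, -⟩ := exists_local_inverse (e := L) (by simp) rfl hφ
    (by rw [hL]; exact (hφ.differentiableAt (by simp)).hasFDerivAt)
  have hinj : ∀ᶠ x in 𝓝 p.1, φ x = φ p.1 → x = p.1 := by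
    filter_upwards [hθ] with x hx hxp
    rw [← hx, hxp, hθ.self_of_nhds]
  exact ControlSystem.exists_analytic_state_transformation _ (E n) (E m) (Nat.lt_succ_self _)
    (matrixCLM A) (matrixCLM B) hAB.eq_top f p hf φ hφ hφ' (fun q => (χ q).2) heq
    (nhds_le_map_control hp hinj hχφ)

/-! ### From the equation back to a conjugacy. -/

/-- A local homeomorphism which satisfies the conjugacy equation near a point becomes a conjugacy
after shrinking its domain. -/
theorem exists_conjugates_restrOpen {f g : E n × E m → E n} (hg : Continuous g)
    {χ : OpenPartialHomeomorph (E n × E m) (E n × E m)} {p : E n × E m} (hp : p ∈ χ.source)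
    (hf : AnalyticAt ℝ f p) {Φ : OpenPartialHomeomorph (E n) (E n)} (hpΦ : p.1 ∈ Φ.source)
    (hΦ : ContDiffAt ℝ 1 Φ p.1) (hΦs : ContDiffAt ℝ 1 Φ.symm (Φ p.1))
    (hχΦ : ∀ᶠ q in 𝓝 p, (χ q).1 = Φ q.1)
    (heq : ∀ᶠ q in 𝓝 p, fderiv ℝ Φ q.1 (f q) = g (χ q)) {P : E n × E m → Prop}
    (hP : ∀ᶠ q in 𝓝 p, P q) :
    ∃ χ' : OpenPartialHomeomorph (E n × E m) (E n × E m), p ∈ χ'.source ∧ (∀ q, χ' q = χ q) ∧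
      (∀ q, χ'.symm q = χ.symm q) ∧ Conjugates f g χ' ∧
      ∀ q ∈ χ'.source, q.1 ∈ Φ.source ∧ (χ q).1 = Φ q.1 ∧ P q := by
  obtain ⟨K₁, s₁, hs₁, hK₁⟩ := hΦ.exists_lipschitzOnWith
  obtain ⟨K₂, s₂, hs₂, hK₂⟩ := hΦs.exists_lipschitzOnWith
  have hfst : Filter.Tendsto (fun q : E n × E m => q.1) (𝓝 p) (𝓝 p.1) := continuous_fst.tendsto p
  have hΦt : Filter.Tendsto (fun q : E n × E m => Φ q.1) (𝓝 p) (𝓝 (Φ p.1)) :=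
    hΦ.continuousAt.tendsto.comp hfst
  have hd : ∀ᶠ x in 𝓝 p.1, DifferentiableAt ℝ Φ x :=
    (hΦ.eventually (by simp)).mono fun x hx => hx.differentiableAt (by simp)
  have hds : ∀ᶠ x in 𝓝 (Φ p.1), DifferentiableAt ℝ Φ.symm x :=
    (hΦs.eventually (by simp)).mono fun x hx => hx.differentiableAt (by simp)
  have hgood : ∀ᶠ q in 𝓝 p, (q ∈ Metric.ball p 1 ∧ χ q ∈ Metric.ball (χ p) 1 ∧
      f q ∈ Metric.ball (f p) 1 ∧ ContinuousAt f q) ∧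
      (q.1 ∈ Φ.source ∧ q.1 ∈ s₁ ∧ Φ q.1 ∈ s₂ ∧ DifferentiableAt ℝ Φ q.1 ∧
        DifferentiableAt ℝ Φ.symm (Φ q.1)) ∧
      (χ q).1 = Φ q.1 ∧ fderiv ℝ Φ q.1 (f q) = g (χ q) ∧ P q := by
    filter_upwards [Metric.ball_mem_nhds p one_pos,
      (χ.continuousAt hp).eventually_mem (Metric.ball_mem_nhds _ one_pos),
      hf.continuousAt.eventually_mem (Metric.ball_mem_nhds _ one_pos),
      hf.eventually_analyticAt, hfst.eventually (Φ.open_source.eventually_mem hpΦ),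
      hfst.eventually_mem hs₁, hΦt.eventually_mem hs₂, hfst.eventually hd, hΦt.eventually hds,
      hχΦ, heq, hP] with q h1 h2 h3 h4 h5 h6 h7 h8 h9 h10 h11 h12
    exact ⟨⟨h1, h2, h3, h4.continuousAt⟩, ⟨h5, h6, h7, h8, h9⟩, h10, h11, h12⟩
  -- One neighbourhood serves both directions: `IsSolution.map` is applied to `χ` and to `χ.symm`,
  -- and each time needs bounded values and a Lipschitz state component.
  obtain ⟨O, hO, hOo, hpO⟩ := eventually_nhds_iff.1 hgood
  let χ' := χ.restrOpen O hOo
  have hsrc : ∀ q ∈ χ'.source, q ∈ O := fun q hq => hq.2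
  have hχ'c : ContinuousOn χ χ'.source := χ'.continuousOn_toFun
  have hχ's : ContinuousOn χ.symm χ'.target := χ'.continuousOn_invFun
  have hmaps : MapsTo χ χ'.source χ'.target := χ'.mapsTo
  have hmapss : MapsTo χ.symm χ'.target χ'.source := χ'.symm.mapsTo
  have hri : ∀ z ∈ χ'.target, χ (χ.symm z) = z := fun z hz => χ'.right_inv hz
  have hbt : Bornology.IsBounded χ'.target := by
    refine (Metric.isBounded_ball (x := χ p) (r := 1)).subset fun z hz => ?_
    rw [← hri z hz]
    exact (hO _ (hsrc _ (hmapss hz))).1.2.1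
  have hbs : Bornology.IsBounded χ'.source :=
    (Metric.isBounded_ball (x := p) (r := 1)).subset fun q hq => (hO _ (hsrc _ hq)).1.1
  have hbg : Bornology.IsBounded (g '' χ'.target) :=
    (hbt.isCompact_closure.image hg).isBounded.subset (image_mono subset_closure)
  have hbf : Bornology.IsBounded (f '' χ'.source) := by
    refine (Metric.isBounded_ball (x := f p) (r := 1)).subset ?_
    rintro _ ⟨q, hq, rfl⟩
    exact (hO _ (hsrc _ hq)).1.2.2.1
  have hfc : ContinuousOn f χ'.source := fun q hq =>
    (hO _ (hsrc _ hq)).1.2.2.2.continuousWithinAt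
  have hzs : ∀ z ∈ χ'.target, z.1 = Φ (χ.symm z).1 := fun z hz => by
    rw [← (hO _ (hsrc _ (hmapss hz))).2.2.1, hri z hz]
  refine ⟨χ', ⟨hp, hpO⟩, fun _ => rfl, fun _ => rfl, ?_, fun q hq => ?_⟩
  · intro I γ hI hγ
    constructor
    · intro hsol
      refine IsSolution.map (φ := Φ) χ'.open_source.measurableSet hχ'c hmaps hbt
        χ'.open_target.measurableSet (fun q hq => (hO q (hsrc q hq)).2.2.1)
        (hK₁.mono ?_) (fun q hq => (hO q (hsrc q hq)).2.1.2.2.2.1) hg.continuousOn hbg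
        (fun q hq => (hO q (hsrc q hq)).2.2.2.1) hI hsol
      rintro _ ⟨q, hq, rfl⟩
      exact (hO q (hsrc q hq)).2.1.2.1
    · intro hsol
      have h1 : IsSolution f χ'.source I (χ.symm ∘ (χ ∘ γ)) := by
        refine IsSolution.map (φ := Φ.symm) χ'.open_target.measurableSet hχ's hmapss hbs
          χ'.open_source.measurableSet (fun z hz => ?_) (hK₂.mono ?_) (fun z hz => ?_) hfc hbf
          (fun z hz => ?_) hI hsol
        · rw [hzs z hz, Φ.left_inv (hO _ (hsrc _ (hmapss hz))).2.1.1]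
        · rintro _ ⟨z, hz, rfl⟩
          rw [hzs z hz]
          exact (hO _ (hsrc _ (hmapss hz))).2.1.2.2.1
        · rw [hzs z hz]
          exact (hO _ (hsrc _ (hmapss hz))).2.1.2.2.2.2
        · have h2 := hO _ (hsrc _ (hmapss hz))
          have h3 := h2.2.1.2.2.2.2.hasFDerivAt.comp _ h2.2.1.2.2.2.1.hasFDerivAt
          have h4 : (Φ.symm ∘ Φ) =ᶠ[𝓝 (χ.symm z).1] id := by
            filter_upwards [Φ.open_source.eventually_mem h2.2.1.1] with x hx
            exact Φ.left_inv hx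
          have h5 := (h3.congr_of_eventuallyEq h4.symm).unique (hasFDerivAt_id _)
          have h6 := h2.2.2.2.1
          rw [hri z hz] at h6
          rw [← h6, hzs z hz]
          exact DFunLike.congr_fun h5 _
      exact h1.congr hI fun t ht => χ'.left_inv (hγ ht)
  · exact ⟨(hO q (hsrc q hq)).2.1.1, (hO q (hsrc q hq)).2.2.1, (hO q (hsrc q hq)).2.2.2.2⟩

/-! ### The two cases of the theorem. -/

theorem exists_analytic_openPartialHomeomorph {V : Type*} [NormedAddCommGroup V]
    [NormedSpace ℝ V] [CompleteSpace V] {k : WithTop ℕ∞} (hk : k ≠ 0) {F : V → V} {a : V}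
    (hF : ContDiffAt ℝ k F a) {e : V ≃L[ℝ] V} (he : HasFDerivAt F (e : V →L[ℝ] V) a) :
    ∃ χ : OpenPartialHomeomorph V V, (∀ x, χ x = F x) ∧ a ∈ χ.source ∧
      ContDiffAt ℝ k χ.symm (χ a) :=
  ⟨hF.toOpenPartialHomeomorph F he hk, fun _ => rfl,
    hF.mem_toOpenPartialHomeomorph_source he hk, hF.to_localInverse he hk⟩

/-- The differential of `χ` is triangular and invertible, so its control block `M` is injective and
satisfies `Dφ ∂f/∂u = B M`. This is what makes the analytic completion of `φ'` a local
diffeomorphism. -/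
theorem LocallyLinearizable.analytic {f : E n × E m → E n} {p : E n × E m}
    (hf : AnalyticAt ℝ f p) (h : LocallyLinearizable ∞ f p) : LocallyLinearizable ω f p := by
  obtain ⟨A, B, hAB, χ, hp, ⟨hχ, hχs⟩, hconj⟩ := h
  refine ⟨A, B, hAB, ?_⟩
  have hχp : ContDiffAt ℝ 1 χ p :=
    (hχ.contDiffAt (χ.open_source.mem_nhds hp)).of_le (by exact_mod_cast le_top)
  have hχsp : ContDiffAt ℝ 1 χ.symm (χ p) :=
    (hχs.contDiffAt (χ.open_target.mem_nhds (χ.map_source hp))).of_le (by exact_mod_cast le_top)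
  have hχd := (hχp.differentiableAt (by simp)).hasFDerivAt
  have hχsd := (hχsp.differentiableAt (by simp)).hasFDerivAt
  have hleft : (fderiv ℝ χ.symm (χ p)).comp (fderiv ℝ χ p) = ContinuousLinearMap.id ℝ _ := by
    refine (hχsd.comp p hχd).congr_of_eventuallyEq ?_ |>.unique (hasFDerivAt_id p)
    filter_upwards [χ.open_source.eventually_mem hp] with x hx using (χ.left_inv hx).symm
  have hinjχ : Function.Injective (fderiv ℝ χ p) :=
    Function.LeftInverse.injective (g := fderiv ℝ χ.symm (χ p)) fun v => DFunLike.congr_fun hleft v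
  have hsurjχ : Function.Surjective (fderiv ℝ χ p) :=
    (LinearMap.injective_iff_surjective
      (f := (fderiv ℝ χ p : (E n × E m) →ₗ[ℝ] (E n × E m)))).1 hinjχ
  let φ : E n → E n := fun x => (χ (x, p.2)).1
  have hφ : ContDiffAt ℝ 1 φ p.1 :=
    (ContDiffAt.fun_comp p.1 (g := χ) hχp (contDiffAt_id.prodMk contDiffAt_const)).fst
  have hφd := (hφ.differentiableAt (by simp)).hasFDerivAt
  have hχφ : ∀ᶠ q in 𝓝 p, (χ q).1 = φ q.1 := by
    have h1 : Filter.Tendsto (fun q : E n × E m => (q.1, p.2)) (𝓝 p) (𝓝 p) :=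
      (Continuous.prodMk_left p.2 |>.comp continuous_fst).tendsto p
    filter_upwards [χ.open_source.eventually_mem hp, hf.eventually_analyticAt,
      h1.eventually (χ.open_source.eventually_mem hp)] with q h2 h3 h4
    exact ((hconj.hasDerivAt (continuous_linearSystem A B) h2 h3).2 _ h4).symm
  have hfst : ∀ d, (fderiv ℝ χ p d).1 = fderiv ℝ φ p.1 d.1 := by
    have h1 : HasFDerivAt (fun q : E n × E m => φ q.1)
        ((fderiv ℝ φ p.1).comp (ContinuousLinearMap.fst ℝ _ _)) p := hφd.comp p hasFDerivAt_fst
    exact fun d => DFunLike.congr_fun (hχd.fst.unique (h1.congr_of_eventuallyEq hχφ)) d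
  have hφ' : Function.Injective (fderiv ℝ φ p.1) := by
    refine (LinearMap.injective_iff_surjective (f := (fderiv ℝ φ p.1 : E n →ₗ[ℝ] E n))).2
      fun z => ?_
    obtain ⟨d, hd⟩ := hsurjχ (z, 0)
    exact ⟨d.1, by have := hfst d; rw [hd] at this; exact this.symm⟩
  obtain ⟨heq, φ', hφa, hφinj, hφmem⟩ :=
    hconj.exists_analytic_state_transformation hAB hp hf hφ hφ' hχφ
  have hinr : HasFDerivAt (fun u : E m => (p.1, u)) (ContinuousLinearMap.inr ℝ (E n) (E m)) p.2 :=
    hasFDerivAt_prodMk_right p.1 p.2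
  let M : E m →L[ℝ] E m := (ContinuousLinearMap.snd ℝ (E n) (E m)).comp
    ((fderiv ℝ χ p).comp (ContinuousLinearMap.inr ℝ (E n) (E m)))
  have hM : Function.Injective M := by
    rw [injective_iff_map_eq_zero]
    intro d hd
    have h1 : fderiv ℝ χ p (0, d) = 0 := by
      refine Prod.ext ?_ hd
      rw [hfst, map_zero]
      rfl
    have h2 := hinjχ (h1.trans (map_zero _).symm)
    exact congrArg Prod.snd h2
  obtain ⟨ψ', hψ', heq', e, he⟩ := exists_control_transformation (k := ω) (k' := ω) (by simp)
    (by simp) hf.contDiffAt hφa.contDiffAt hφinj hφmem hM (by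
      intro d hd
      have h1 : HasFDerivAt (fun u => fderiv ℝ φ p.1 (f (p.1, u))) _ p.2 :=
        (fderiv ℝ φ p.1).hasFDerivAt.comp p.2
          (HasFDerivAt.comp p.2 (g := f) hf.differentiableAt.hasFDerivAt hinr)
      have h2 : HasFDerivAt
          (fun u => matrixCLM A (φ p.1) + matrixCLM B (χ (p.1, u)).2) _ p.2 :=
        ((matrixCLM B).hasFDerivAt.comp p.2
          (HasFDerivAt.comp p.2 (g := χ) hχd hinr).snd).const_add _
      have h3 : (fun u => fderiv ℝ φ p.1 (f (p.1, u))) =ᶠ[𝓝 p.2]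
          fun u => matrixCLM A (φ p.1) + matrixCLM B (χ (p.1, u)).2 :=
        ((Continuous.prodMk_right p.1).tendsto p.2).eventually heq
      have h4 := DFunLike.congr_fun (h1.unique (h2.congr_of_eventuallyEq h3)) d
      have h5 : fderiv ℝ φ p.1 (fderiv ℝ f p (0, d)) = matrixCLM B (M d) := h4
      rw [← h5, hd, map_zero])
  obtain ⟨L, hL⟩ := exists_continuousLinearEquiv_of_injective hφinj
  obtain ⟨Φ, hΦ, hpΦ, hΦs⟩ := exists_analytic_openPartialHomeomorph (k := ω) (by simp)
    hφa.contDiffAt (e := L) (by rw [hL]; exact hφa.differentiableAt.hasFDerivAt)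
  have hFa : ContDiffAt ℝ ω (fun q : E n × E m => (φ' q.1, ψ' q)) p :=
    (hφa.contDiffAt.fun_comp p contDiffAt_fst).prodMk hψ'
  obtain ⟨Χ, hΧ, hpΧ, hΧs⟩ := exists_analytic_openPartialHomeomorph (k := ω) (by simp) hFa he
  obtain rfl : φ' = Φ := (funext hΦ).symm
  obtain ⟨χ', hpχ', hχ', hχs', hconj', hprop⟩ := exists_conjugates_restrOpen
    (continuous_linearSystem A B) hpΧ hf hpΦ hφa.contDiffAt (hΦs.of_le le_top)
    (Filter.Eventually.of_forall fun q => by rw [hΧ]) (heq'.mono fun q hq => by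
      rw [hq, linearSystem_apply, hΧ])
    (P := fun q => ContDiffAt ℝ ω Χ q ∧ ContDiffAt ℝ ω Χ.symm (Χ q)) (by
      rw [← funext hΧ] at hFa
      exact (hFa.eventually (by simp)).and
        (hFa.continuousAt.eventually (hΧs.eventually (by simp))))
  refine ⟨χ', hpχ', ⟨fun q hq => ?_, fun z hz => ?_⟩, hconj'⟩
  · have := (hprop q hq).2.2.1
    rw [← funext hχ'] at this
    exact this.contDiffWithinAt
  · have := (hprop _ (χ'.symm.map_source hz)).2.2.2
    rw [← hχ', ← funext hχs'] at this
    have h2 : χ' (χ'.symm z) = z := χ'.right_inv hz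
    rw [h2] at this
    exact this.contDiffWithinAt

/-- The new conjugacy is `S ∘ χ`, with `S` a local `C¹` diffeomorphism over `T = φ' ∘ χ₁⁻¹` that
preserves the linear system. It is only a homeomorphism, but its state component is the analytic
`φ'`. -/
theorem LocallyQuasiLinearizable.analytic {f : E n × E m → E n} {p : E n × E m}
    (hf : AnalyticAt ℝ f p) (h : LocallyQuasiLinearizable ∞ f p) :
    LocallyQuasiLinearizable ω f p := by
  obtain ⟨A, B, hAB, χ, hp, ⟨χ₁, hsrc, htgt, hχχ₁, hχ₁, hχ₁s⟩, hconj⟩ := h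
  refine ⟨A, B, hAB, ?_⟩
  have hp₁ : p.1 ∈ χ₁.source := by rw [hsrc]; exact mem_image_of_mem _ hp
  have h2 : (2 : WithTop ℕ∞) ≤ ∞ := WithTop.coe_le_coe.2 (le_top : (2 : ℕ∞) ≤ ⊤)
  have h2p : ∀ x ∈ χ₁.source, ContDiffAt ℝ 2 χ₁ x := fun x hx =>
    (hχ₁.contDiffAt (χ₁.open_source.mem_nhds hx)).of_le h2
  have h2s : ∀ z ∈ χ₁.target, ContDiffAt ℝ 2 χ₁.symm z := fun z hz =>
    (hχ₁s.contDiffAt (χ₁.open_target.mem_nhds hz)).of_le h2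
  have hd₁ : ∀ x ∈ χ₁.source, HasFDerivAt χ₁ (fderiv ℝ χ₁ x) x := fun x hx =>
    ((h2p x hx).differentiableAt (by simp)).hasFDerivAt
  have hd₁s : ∀ x ∈ χ₁.source, HasFDerivAt χ₁.symm (fderiv ℝ χ₁.symm (χ₁ x)) (χ₁ x) := fun x hx =>
    ((h2s _ (χ₁.map_source hx)).differentiableAt (by simp)).hasFDerivAt
  have hleft : (fderiv ℝ χ₁.symm (χ₁ p.1)).comp (fderiv ℝ χ₁ p.1) =
      ContinuousLinearMap.id ℝ _ := by
    refine ((hd₁s _ hp₁).comp p.1 (hd₁ _ hp₁)).congr_of_eventuallyEq ?_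
      |>.unique (hasFDerivAt_id p.1)
    filter_upwards [χ₁.open_source.eventually_mem hp₁] with x hx using (χ₁.left_inv hx).symm
  have hright : (fderiv ℝ χ₁ p.1).comp (fderiv ℝ χ₁.symm (χ₁ p.1)) =
      ContinuousLinearMap.id ℝ _ := by
    have h1 := hd₁ _ hp₁
    have h2 := hd₁s _ hp₁
    rw [← χ₁.left_inv hp₁] at h1
    have h3 := (h1.comp (χ₁ p.1) h2).congr_of_eventuallyEq (f₁ := id) ?_
      |>.unique (hasFDerivAt_id (χ₁ p.1))
    · rwa [χ₁.left_inv hp₁] at h3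
    filter_upwards [χ₁.open_target.eventually_mem (χ₁.map_source hp₁)] with x hx
      using (χ₁.right_inv hx).symm
  have hφ' : Function.Injective (fderiv ℝ χ₁ p.1) :=
    Function.LeftInverse.injective (g := fderiv ℝ χ₁.symm (χ₁ p.1))
      fun v => DFunLike.congr_fun hleft v
  have hφs' : Function.Injective (fderiv ℝ χ₁.symm (χ₁ p.1)) :=
    Function.LeftInverse.injective (g := fderiv ℝ χ₁ p.1) fun v => DFunLike.congr_fun hright v
  have hχφ : ∀ᶠ q in 𝓝 p, (χ q).1 = χ₁ q.1 :=
    (χ.open_source.eventually_mem hp).mono hχχ₁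
  obtain ⟨heq, φ', hφa, hφinj, hφmem⟩ := hconj.exists_analytic_state_transformation hAB hp hf
    ((h2p _ hp₁).of_le (by norm_num)) hφ' hχφ
  -- the transition from the smooth to the analytic state coordinates
  let T : E n → E n := fun z => φ' (χ₁.symm z)
  have hz₀ : (χ p).1 = χ₁ p.1 := hχχ₁ p hp
  have hT : ContDiffAt ℝ 2 T (χ p).1 := by
    rw [hz₀]
    refine ContDiffAt.fun_comp (χ₁ p.1) (g := φ') ?_ (h2s _ (χ₁.map_source hp₁))
    rw [χ₁.left_inv hp₁]
    exact hφa.contDiffAt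
  have hT' : Function.Injective (fderiv ℝ T (χ p).1) := by
    have h1 : HasFDerivAt φ' (fderiv ℝ φ' p.1) (χ₁.symm (χ₁ p.1)) := by
      rw [χ₁.left_inv hp₁]; exact hφa.differentiableAt.hasFDerivAt
    have h2 : HasFDerivAt T _ (χ₁ p.1) := h1.comp (χ₁ p.1) (hd₁s _ hp₁)
    rw [hz₀, h2.fderiv]
    exact hφinj.comp hφs'
  have hχt : Filter.Tendsto χ (𝓝 p) (𝓝 (χ p)) := (χ.continuousAt hp).tendsto
  have hfst : Filter.Tendsto (fun q : E n × E m => q.1) (𝓝 p) (𝓝 p.1) := continuous_fst.tendsto p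
  have hTd : ∀ᶠ z in 𝓝 (χ p).1, DifferentiableAt ℝ T z :=
    (hT.eventually (by simp)).mono fun z hz => hz.differentiableAt (by simp)
  have hTφ : ∀ᶠ q in 𝓝 p, T (χ q).1 = φ' q.1 ∧
      fderiv ℝ T (χ q).1 (linearSystem A B (χ q)) = fderiv ℝ φ' q.1 (f q) := by
    filter_upwards [χ.open_source.eventually_mem hp, heq,
      ((continuous_fst.tendsto (χ p)).comp hχt).eventually hTd,
      hfst.eventually hφa.eventually_analyticAt] with q h1 h2 h3 h4
    have hq₁ : q.1 ∈ χ₁.source := by rw [hsrc]; exact mem_image_of_mem _ h1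
    have h3' : DifferentiableAt ℝ T (χ₁ q.1) := by rw [← hχχ₁ q h1]; exact h3
    have h5 : (fun x => T (χ₁ x)) =ᶠ[𝓝 q.1] φ' := by
      filter_upwards [χ₁.open_source.eventually_mem hq₁] with x hx
      simp only [T, χ₁.left_inv hx]
    have h6 : HasFDerivAt (fun x => T (χ₁ x)) _ q.1 := h3'.hasFDerivAt.comp q.1 (hd₁ _ hq₁)
    have h7 := (h4.differentiableAt.hasFDerivAt.congr_of_eventuallyEq h5).unique h6
    refine ⟨by rw [hχχ₁ q h1]; exact h5.self_of_nhds, ?_⟩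
    rw [linearSystem_apply, hχχ₁ q h1, ← h2, h7]
    rfl
  have hTmem : ∀ᶠ s in 𝓝 (χ p), fderiv ℝ T s.1 (linearSystem A B s) - matrixCLM A (T s.1) ∈
      LinearMap.range (matrixCLM B : E m →ₗ[ℝ] E n) := by
    have h1 := (χ.continuousAt_symm (χ.map_source hp)).tendsto
    rw [χ.left_inv hp] at h1
    filter_upwards [χ.open_target.eventually_mem (χ.map_source hp), h1.eventually hTφ,
      h1.eventually hφmem] with s h2 h3 h4
    rw [χ.right_inv h2] at h3
    rwa [h3.1, h3.2]
  have hlin : ContDiff ℝ 1 (linearSystem A B) := by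
    rw [linearSystem_eq_coprod]; exact ContinuousLinearMap.contDiff _
  -- `ψ'` involves the differential of `T`, so `T` of class `C²` gives the `C¹` regularity that
  -- local inversion requires. For the linear system `∂g/∂v = B`, so `M` can be the identity.
  obtain ⟨ψ', hψ', heq', e, he⟩ := exists_control_transformation (k := 1) (k' := 2) (by simp)
    one_add_one_eq_two.le hlin.contDiffAt hT hT' hTmem (M := ContinuousLinearMap.id ℝ (E m))
    Function.injective_id (by
      intro d hd
      rw [linearSystem_eq_coprod, ContinuousLinearMap.fderiv] at hd
      simpa using hd)
  have hS : ContDiffAt ℝ 1 (fun s : E n × E m => (T s.1, ψ' s)) (χ p) :=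
    ((hT.of_le (by norm_num)).fun_comp (χ p) contDiffAt_fst).prodMk hψ'
  obtain ⟨S, hSeq, hpS, -⟩ := exists_analytic_openPartialHomeomorph (by simp) hS he
  obtain ⟨L, hL⟩ := exists_continuousLinearEquiv_of_injective hφinj
  obtain ⟨Φ, hΦ, hpΦ, hΦs⟩ := exists_analytic_openPartialHomeomorph (k := ω) (by simp)
    hφa.contDiffAt (e := L) (by rw [hL]; exact hφa.differentiableAt.hasFDerivAt)
  obtain rfl : φ' = Φ := (funext hΦ).symm
  have hΧ : ∀ q, (χ.trans S) q = (T (χ q).1, ψ' (χ q)) := fun q => hSeq (χ q)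
  obtain ⟨χ', hpχ', hχ', -, hconj', hprop⟩ := exists_conjugates_restrOpen
    (χ := χ.trans S) (continuous_linearSystem A B) (by
      rw [OpenPartialHomeomorph.trans_source]; exact ⟨hp, hpS⟩)
    hf hpΦ hφa.contDiffAt (hΦs.of_le le_top)
    (hTφ.mono fun q hq => by rw [hΧ]; exact hq.1)
    (by
      filter_upwards [hTφ, hχt.eventually heq'] with q h1 h2
      rw [← h1.2, h2, linearSystem_apply, hΧ])
    (P := fun q => ContDiffAt ℝ ω Φ q.1 ∧ ContDiffAt ℝ ω Φ.symm (Φ q.1)) (by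
      exact (hfst.eventually (hφa.contDiffAt.eventually (by simp))).and
        (hfst.eventually (hφa.continuousAt.eventually (hΦs.eventually (by simp)))))
  have hopen : IsOpen (Prod.fst '' χ'.source) := isOpenMap_fst _ χ'.open_source
  -- The definition asks the domain of the state diffeomorphism to be exactly the projection of
  -- `χ'.source`.
  let Φ' := Φ.restrOpen _ hopen
  have hΦ's : Φ'.source = Prod.fst '' χ'.source := by
    refine inter_eq_right.2 ?_
    rintro _ ⟨q, hq, rfl⟩
    exact (hprop q hq).1
  have hχΦ : ∀ q ∈ χ'.source, (χ' q).1 = Φ' q.1 := fun q hq => by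
    rw [hχ']; exact (hprop q hq).2.1
  refine ⟨χ', hpχ', ⟨Φ', hΦ's, ?_, hχΦ, ?_, ?_⟩, hconj'⟩
  · rw [← Φ'.image_source_eq_target, ← χ'.image_source_eq_target, hΦ's, image_image, image_image]
    exact image_congr fun q hq => (hχΦ q hq).symm
  · intro x hx
    rw [hΦ's] at hx
    obtain ⟨q, hq, rfl⟩ := hx
    exact (hprop q hq).2.2.1.contDiffWithinAt
  · intro z hz
    have hx := Φ'.symm.map_source hz
    have hzr : Φ (Φ'.symm z) = z := Φ'.right_inv hz
    have hx' : Φ'.symm z ∈ Prod.fst '' χ'.source := by rw [← hΦ's]; exact hx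
    obtain ⟨q, hq, hqz⟩ := hx'
    have := (hprop q hq).2.2.2
    rw [hqz, hzr] at this
    exact this.contDiffWithinAt

end ControlSystem

theorem corollary5p8 {n m : ℕ} (f : ControlSystem.E n × ControlSystem.E m → ControlSystem.E n)
    (Ω : Set (ControlSystem.E n × ControlSystem.E m)) (hΩ : IsOpen Ω) (hf : AnalyticOnNhd ℝ f Ω)
    (p : ControlSystem.E n × ControlSystem.E m) (hp : p ∈ Ω) :
    (ControlSystem.LocallyLinearizable ∞ f p → ControlSystem.LocallyLinearizable ω f p) ∧
    (ControlSystem.LocallyQuasiLinearizable ∞ f p →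
      ControlSystem.LocallyQuasiLinearizable ω f p) :=
  ⟨ControlSystem.LocallyLinearizable.analytic (hf p hp),
    ControlSystem.LocallyQuasiLinearizable.analytic (hf p hp)⟩
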